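/- Let $(V,h)$ be an oriented eight-dimensional Euclidean vector space with volume form $\nu\in\wedge^8V^*$ and Hodge star $*$, and let $\langle\cdot,\cdot\rangle$ denote the metric induced by $h$ on exterior forms. Let $\gamma\colon\mathbb{C}\mathrm{l}(V^*,h^*)\to\mathrm{End}_{\mathbb{C}}(\Sigma)$ be an irreducible complex Clifford module, where $\theta^2=h^*(\theta,\theta)$ for $\theta\in V^*$, and let $\Psi_\gamma\colon\wedge V^*_{\mathbb{C}}\to\mathrm{End}_{\mathbb{C}}(\Sigma)$ be the isomorphism obtained by composing $\gamma$ with the complexified Chevalley–Riesz isomorphism $\wedge V^*_{\mathbb{C}}\cong\mathbb{C}\mathrm{l}(V^*,h^*)$, under which $\theta\wedge\alpha+\iota_{\theta^\sharp}\alpha$ corresponds to the Clifford product of $\theta\in V^*$ and $\alpha$. Let $\mathscr{S}$ be a positive-definite Hermitian inner product on $\Sigma$, conjugate-linear in the second entry, with $\mathscr{S}(\gamma(z)\xi,\chi)=\mathscr{S}(\xi,\gamma(\overline{\tau(z)})\chi)$ for all $z\in\mathbb{C}\mathrm{l}(V^*,h^*)$ and $\xi,\chi\in\Sigma$, where $\tau$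 is the reversion. The Hermitian square of $\eta\in\Sigma$ is $\Psi_\gamma^{-1}(\eta\otimes\mathscr{S}(-,\eta))\in\wedge V^*_{\mathbb{C}}$. For $\mu\in\{+1,-1\}$ let $\Sigma^\mu=\{\eta\in\Sigma\mid\Psi_\gamma(\nu)\eta=\mu\eta\}$ be the space of spinors of chirality $\mu$. For exterior forms $\alpha,\beta$ and an orthonormal basis $(e_i)$ of $V$ set $\alpha\triangle_2\beta=\tfrac12\sum_{i,j}(\iota_{e_i}\iota_{e_j}\alpha)\wedge(\iota_{e_i}\iota_{e_j}\beta)$. Then a complex exterior form $\widehat{\alpha}\in\wedge V^*_{\mathbb{C}}$ is the Hermitian square of a non-zero spinor $\eta\in\Sigma^\mu$ if and only if $$\widehat{\alpha}=\sqrt{\frac{2\langle\omega,\omega\rangle+\langle\Theta,\Theta\rangle}{14}}+i\omega+\Theta-i\mu*\omega+\sqrt{\frac{2\langle\omega,\omega\rangle+\langle\Theta,\Theta\rangle}{14\langle\Theta,\Theta\rangle^2}}\;\Theta\wedge\Theta$$ for a real two-form $\omega\in\wedge^2V^*$ and a non-zero real four-form $\Theta\in\wedge^4V^*$ satisfying $*\Theta=\mu\Theta$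 and $$2\,\omega\wedge\omega+2\mu*(\omega\wedge\omega)+\Theta\triangle_2\Theta+12\sqrt{\frac{2\langle\omega,\omega\rangle+\langle\Theta,\Theta\rangle}{14}}\;\Theta=0,$$ $$\omega\wedge\Theta+3\mu\sqrt{\frac{2\langle\omega,\omega\rangle+\langle\Theta,\Theta\rangle}{14}}\;*\omega=0.$$ The same equivalence holds for all $\eta\in\Sigma^\mu$ and all $\Theta$ (zero allowed on both sides), provided the last term of the expression for $\widehat{\alpha}$ is read as $0$ when $\Theta=0$. -/

import Mathlib

open scoped TensorProduct InnerProductSpace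

noncomputable section

namespace SpinorSquare

/-! ### Euclidean exterior algebra -/

section Forms

variable (V : Type*) [NormedAddCommGroup V] [InnerProductSpace ℝ V] [FiniteDimensional ℝ V]

/-- Real exterior forms on `V`, i.e. the exterior algebra of the dual space. -/
abbrev Forms : Type _ := ExteriorAlgebra ℝ (Module.Dual ℝ V)

/-- Complex exterior forms, `(⋀ V*) ⊗ ℂ = ⋀ (V* ⊗ ℂ)`. -/
abbrev ComplexForms : Type _ := ℂ ⊗[ℝ] Forms V

/-- The musical isomorphism `v ↦ ⟪v, ·⟫` from `V` to its dual. -/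
def flat : V ≃ₗ[ℝ] Module.Dual ℝ V :=
  LinearEquiv.ofBijective (innerₗ V) (by
    have hinj : Function.Injective (innerₗ V) := fun v w h => by
      refine ext_inner_right ℝ fun u => ?_
      simpa using LinearMap.congr_fun h u
    exact ⟨hinj, (LinearMap.injective_iff_surjective_of_finrank_eq_finrank
      (Subspace.dual_finrank_eq (K := ℝ) (V := V)).symm).1 hinj⟩)

/-- The musical isomorphism `θ ↦ θ♯` from the dual of `V` to `V`. -/
def sharp : Module.Dual ℝ V ≃ₗ[ℝ] V := (flat V).symm

/-- The metric on the dual space, `h*(θ, φ) = ⟪θ♯, φ♯⟫`. -/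
def dualMetric : LinearMap.BilinForm ℝ (Module.Dual ℝ V) :=
  (innerₗ V).compl₁₂ (sharp V).toLinearMap (sharp V).toLinearMap

/-- The quadratic form `θ ↦ h*(θ, θ)` on the dual space. -/
def dualQuadraticForm : QuadraticForm ℝ (Module.Dual ℝ V) :=
  LinearMap.BilinMap.toQuadraticMap (dualMetric V)

variable {V}

/-- Interior product of a form with a vector. -/
def interiorProd (v : V) : Forms V →ₗ[ℝ] Forms V :=
  CliffordAlgebra.contractLeft (Module.Dual.eval ℝ V v)

/-- Auxiliary sum `∑ (ι_{e_{i₁}} ⋯ ι_{e_{iₖ}} α) ∧ (ι_{e_{i₁}} ⋯ ι_{e_{iₖ}} β)` over all indices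
`i₁, …, iₖ`, for an orthonormal basis `e` of `V`. -/
def contractedWedge : ℕ → Forms V → Forms V → Forms V
  | 0, α, β => α * β
  | k + 1, α, β => ∑ i, contractedWedge k (interiorProd (stdOrthonormalBasis ℝ V i) α)
      (interiorProd (stdOrthonormalBasis ℝ V i) β)

/-- The generalized product `α △ₖ β` of exterior forms (it does not depend on the orthonormal
basis used to write it down). -/
def genProduct (k : ℕ) (α β : Forms V) : Forms V :=
  ((k.factorial : ℝ)⁻¹) • contractedWedge k α β

/-- The inner product on `k`-forms induced by the metric, normalized by
`⟨θ₁ ∧ ⋯ ∧ θₖ, φ₁ ∧ ⋯ ∧ φₖ⟩ = det (h*(θᵢ, φⱼ))`. -/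
def formInner (k : ℕ) (α β : ⋀[ℝ]^k (Module.Dual ℝ V)) : ℝ :=
  exteriorPower.pairingDual ℝ V k α (exteriorPower.map k (sharp V).toLinearMap β)

/-- The Riemannian volume form `e¹ ∧ ⋯ ∧ e⁸`, for a positively oriented orthonormal basis. -/
def volForm [hV : Fact (Module.finrank ℝ V = 8)] (o : Orientation ℝ V (Fin 8)) : Forms V :=
  ExteriorAlgebra.ιMulti ℝ 8
    fun i => flat V (o.finOrthonormalBasis (by norm_num) hV.out i)

/-- Contraction of a form by the multivector dual to another form, determined by
`θ₁ ∧ ⋯ ∧ θₖ ↦ ι_{θₖ♯} ⋯ ι_{θ₁♯}`; it reverses products, whence the opposite algebra. -/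
def multiContract : Forms V →ₐ[ℝ] (Module.End ℝ (Forms V))ᵐᵒᵖ :=
  ExteriorAlgebra.lift ℝ
    ⟨(MulOpposite.opLinearEquiv ℝ).toLinearMap ∘ₗ CliffordAlgebra.contractLeft ∘ₗ
        Module.Dual.eval ℝ V ∘ₗ (sharp V).toLinearMap, fun θ => by
      refine MulOpposite.unop_injective (LinearMap.ext fun x => ?_)
      exact CliffordAlgebra.contractLeft_contractLeft _ x⟩

/-- The Hodge star operator, `*(θ₁ ∧ ⋯ ∧ θₖ) = ι_{θₖ♯} ⋯ ι_{θ₁♯} ν`, equivalently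
`α ∧ *β = ⟨α, β⟩ ν`. -/
def hodge [Fact (Module.finrank ℝ V = 8)] (o : Orientation ℝ V (Fin 8)) (α : Forms V) : Forms V :=
  (multiContract α).unop (volForm o)

end Forms

/-! ### Clifford modules and spinor squares -/

section Modules

variable (V : Type*) [NormedAddCommGroup V] [InnerProductSpace ℝ V] [FiniteDimensional ℝ V]

/-- The complexified Clifford algebra of the dual space, with convention `θ² = h*(θ, θ)`. -/
abbrev ComplexClifford : Type _ := ℂ ⊗[ℝ] CliffordAlgebra (dualQuadraticForm V)

/-- The complexified Chevalley-Riesz isomorphism. It sends `1` to `1`, and the form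
`θ ∧ α + ι_{θ♯} α` to the Clifford product of `θ` and the image of `α`. -/
def chevalleyRiesz : ComplexForms V →ₗ[ℂ] ComplexClifford V :=
  (CliffordAlgebra.equivExterior (dualQuadraticForm V)).symm.toLinearMap.baseChange ℂ

/-- The conjugate-linear reversion `c ⊗ x ↦ c̄ ⊗ τ(x)`, that is `z ↦` conjugate of `τ(z)`. -/
def conjReverse : ComplexClifford V →ₗ[ℝ] ComplexClifford V :=
  TensorProduct.map Complex.conjAe.toLinearMap CliffordAlgebra.reverse

variable {V}
variable {S : Type*} [AddCommGroup S] [Module ℂ S]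

/-- Irreducibility of a complex Clifford module. -/
def IsIrreducibleModule (γ : ComplexClifford V →ₐ[ℂ] Module.End ℂ S) : Prop :=
  Nontrivial S ∧ ∀ W : Submodule ℂ S, (∀ z, ∀ x ∈ W, γ z x ∈ W) → W = ⊥ ∨ W = ⊤

/-- `B` is a Hermitian inner product on the Clifford module which is admissible of positive
adjoint type. Pairings are linear in the first and conjugate-linear in the second entry. -/
structure IsAdmissibleInner (γ : ComplexClifford V →ₐ[ℂ] Module.End ℂ S)
    (B : S →ₗ[ℂ] S →ₗ⋆[ℂ] ℂ) : Prop where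
  hermitian : ∀ x y, B x y = starRingEnd ℂ (B y x)
  pos_def : ∀ x, x ≠ 0 → 0 < (B x x).re
  adjoint : ∀ z x y, B (γ z x) y = B x (γ (conjReverse V z) y)

/-- The isomorphism `Ψ_γ` from complex forms to endomorphisms of the Clifford module. -/
def quantize (γ : ComplexClifford V →ₐ[ℂ] Module.End ℂ S) : ComplexForms V →ₗ[ℂ] Module.End ℂ S :=
  γ.toLinearMap ∘ₗ chevalleyRiesz V

/-- `α` is the Hermitian square of `η` (with phase one): `α = Ψ_γ⁻¹ (η ⊗ B(·, η))`. -/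
def IsHermitianSquare (γ : ComplexClifford V →ₐ[ℂ] Module.End ℂ S) (B : S →ₗ[ℂ] S →ₗ⋆[ℂ] ℂ)
    (η : S) (α : ComplexForms V) : Prop :=
  quantize γ α = (B.flip η).smulRight η

/-- `η` is chiral of chirality `μ`. In dimension eight the complex volume form is `ν`. -/
def IsChiral [Fact (Module.finrank ℝ V = 8)] (o : Orientation ℝ V (Fin 8))
    (γ : ComplexClifford V →ₐ[ℂ] Module.End ℂ S) (μ : ℝ) (η : S) : Prop :=
  quantize γ (1 ⊗ₜ[ℝ] volForm o) η = (μ : ℂ) • η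

end Modules

/-! ### The form built from a two-form and a four-form -/

section EightDim

variable {V : Type*} [NormedAddCommGroup V] [InnerProductSpace ℝ V] [FiniteDimensional ℝ V]

/-- `r = √((2⟨ω,ω⟩ + ⟨Θ,Θ⟩) / 14)`. -/
def radius (ω : ⋀[ℝ]^2 (Module.Dual ℝ V)) (Θ : ⋀[ℝ]^4 (Module.Dual ℝ V)) : ℝ :=
  √((2 * formInner 2 ω ω + formInner 4 Θ Θ) / 14)

/-- `r + iω + Θ - iμ*ω + √((2⟨ω,ω⟩ + ⟨Θ,Θ⟩) / (14⟨Θ,Θ⟩²)) Θ∧Θ`. -/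
def squareForm [Fact (Module.finrank ℝ V = 8)] (o : Orientation ℝ V (Fin 8)) (μ : ℝ)
    (ω : ⋀[ℝ]^2 (Module.Dual ℝ V)) (Θ : ⋀[ℝ]^4 (Module.Dual ℝ V)) : ComplexForms V :=
  (radius ω Θ : ℂ) ⊗ₜ[ℝ] 1 + Complex.I ⊗ₜ[ℝ] (ω : Forms V) + 1 ⊗ₜ[ℝ] (Θ : Forms V)
    - (Complex.I * μ) ⊗ₜ[ℝ] hodge o (ω : Forms V)
    + (√((2 * formInner 2 ω ω + formInner 4 Θ Θ) / (14 * formInner 4 Θ Θ ^ 2)) : ℂ) ⊗ₜ[ℝ]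
        ((Θ : Forms V) * (Θ : Forms V))

/-- The (anti-)self-duality condition and the quadratic system for `(ω, Θ)`. -/
structure SolvesSystem [Fact (Module.finrank ℝ V = 8)] (o : Orientation ℝ V (Fin 8)) (μ : ℝ)
    (ω : ⋀[ℝ]^2 (Module.Dual ℝ V)) (Θ : ⋀[ℝ]^4 (Module.Dual ℝ V)) : Prop where
  selfDual : hodge o (Θ : Forms V) = μ • (Θ : Forms V)
  quad₁ : (2 : ℝ) • ((ω : Forms V) * (ω : Forms V))
      + (2 * μ) • hodge o ((ω : Forms V) * (ω : Forms V))
      + genProduct 2 (Θ : Forms V) (Θ : Forms V)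
      + (12 * radius ω Θ) • (Θ : Forms V) = 0
  quad₂ : (ω : Forms V) * (Θ : Forms V) + (3 * μ * radius ω Θ) • hodge o (ω : Forms V) = 0

end EightDim

end SpinorSquare

end

/-! In dimension eight the irreducible module has dimension 16 and the complexified Clifford algebra
is its full endomorphism algebra. A form is therefore a Hermitian square exactly when its operator
`E` is one, and the operators `η ⊗ B(·, η)` are intrinsic: they are the self-adjoint `E` with `E² =
tr(E) E` and `tr E ≥ 0`. One direction is immediate; for the other, if `tr E = c > 0` then `c⁻¹E` is
an idempotent of trace one, hence of rank one (`exists_eq_smulRight`). The spinor is chiral exactly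
when `νE = μE`.

These conditions are translated into forms. Self-adjointness fixes the reversion sign of the real
and imaginary parts. Together with chirality on the left it gives chirality on the right, so
conjugation by `ν` is trivial and only even degrees survive (`degPart_eq_zero_of_vol`). Left
multiplication by `ν` exchanges degrees `p` and `8 - p` through the Hodge star, which leaves the
real part `r + Θ + μrν` with `*Θ = μΘ` and the imaginary part `ω - μ*ω` (`eq_evenPart`,
`eq_skewPart`). Forms of even positive degree act without trace, so `tr E = 16 r`.

Then `E² = 16 r E` is expanded by the formula for the Clifford product in contracted wedge products
(`quant_mul_quant`). Its components of degrees 0, 4 and 6 are `14 r² = 2⟨ω,ω⟩ + ⟨Θ,Θ⟩` and the two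
quadratic equations; the components of degrees 8 and 2 are Hodge dual to those of degrees 0 and 6
(`clifford_square_iff`). Since `Θ ∧ Θ = μ⟨Θ,Θ⟩ν`, the square-root coefficient in the statement
encodes `μrν`. Finally `B η η = 16 r`, and `Θ = 0` forces `r = 0`, so nonzero spinors correspond to
nonzero `Θ`. -/

noncomputable section

namespace SpinorSquare

set_option linter.unusedSectionVars false

/-! ### Interior products and contracted wedge products. -/

section ExteriorCalculus

variable {V : Type*} [NormedAddCommGroup V] [InnerProductSpace ℝ V] [FiniteDimensional ℝ V]

/-- The one-form dual to a vector, as an exterior form. -/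
def oneForm (v : V) : Forms V := ExteriorAlgebra.ι ℝ (flat V v)

@[simp] theorem flat_apply (v w : V) : flat V v w = ⟪v, w⟫_ℝ := rfl

theorem ι_eq_oneForm (θ : Module.Dual ℝ V) : ExteriorAlgebra.ι ℝ θ = oneForm (sharp V θ) := by
  simp [oneForm, sharp]

theorem interiorProd_ι_mul (v : V) (θ : Module.Dual ℝ V) (x : Forms V) :
    interiorProd v (ExteriorAlgebra.ι ℝ θ * x) =
      θ v • x - ExteriorAlgebra.ι ℝ θ * interiorProd v x :=
  CliffordAlgebra.contractLeft_ι_mul (Q := 0) _ _ _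

theorem interiorProd_oneForm_mul (v w : V) (x : Forms V) :
    interiorProd v (oneForm w * x) = ⟪w, v⟫_ℝ • x - oneForm w * interiorProd v x :=
  interiorProd_ι_mul _ _ _

@[simp] theorem interiorProd_algebraMap (v : V) (r : ℝ) :
    interiorProd v (algebraMap ℝ (Forms V) r) = 0 :=
  CliffordAlgebra.contractLeft_algebraMap (Q := 0) _ _

@[simp] theorem interiorProd_one (v : V) : interiorProd v (1 : Forms V) = 0 :=
  CliffordAlgebra.contractLeft_one (Q := 0) _

theorem interiorProd_comm (v w : V) (x : Forms V) :
    interiorProd v (interiorProd w x) = -interiorProd w (interiorProd v x) :=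
  CliffordAlgebra.contractLeft_comm _ _ _

theorem interiorProd_smul_left (c : ℝ) (v : V) (x : Forms V) :
    interiorProd (c • v) x = c • interiorProd v x := by
  simp [interiorProd]

theorem interiorProd_sum_left {ι : Type*} (s : Finset ι) (f : ι → V) (x : Forms V) :
    interiorProd (∑ i ∈ s, f i) x = ∑ i ∈ s, interiorProd (f i) x := by
  simp [interiorProd]

theorem oneForm_mem (v : V) : oneForm v ∈ ⋀[ℝ]^1 (Module.Dual ℝ V) := by
  simp [oneForm]

theorem mul_mem_exteriorPower {p q : ℕ} {x y : Forms V} (hx : x ∈ ⋀[ℝ]^p (Module.Dual ℝ V))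
    (hy : y ∈ ⋀[ℝ]^q (Module.Dual ℝ V)) : x * y ∈ ⋀[ℝ]^(p + q) (Module.Dual ℝ V) :=
  SetLike.mul_mem_graded (A := fun i : ℕ => ⋀[ℝ]^i (Module.Dual ℝ V)) hx hy

theorem oneForm_mul_mem {p : ℕ} {x : Forms V} (v : V) (hx : x ∈ ⋀[ℝ]^p (Module.Dual ℝ V)) :
    oneForm v * x ∈ ⋀[ℝ]^(p + 1) (Module.Dual ℝ V) := by
  rw [add_comm]; exact mul_mem_exteriorPower (oneForm_mem v) hx

theorem mem_exteriorPower_zero {x : Forms V} :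
    x ∈ ⋀[ℝ]^0 (Module.Dual ℝ V) ↔ ∃ r : ℝ, algebraMap ℝ (Forms V) r = x := by
  simp [Submodule.mem_one]

/-- Induction over forms of positive degree. -/
theorem exteriorPower_succ_induction {p : ℕ} {P : Forms V → Prop} (add : ∀ x y, P x → P y → P (x + y))
    (mul : ∀ v, ∀ x ∈ ⋀[ℝ]^p (Module.Dual ℝ V), P (oneForm v * x)) :
    ∀ x ∈ ⋀[ℝ]^(p + 1) (Module.Dual ℝ V), P x := by
  intro x hx
  change x ∈ LinearMap.range (ExteriorAlgebra.ι ℝ) ^ (p + 1) at hx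
  rw [pow_succ'] at hx
  refine Submodule.mul_induction_on hx ?_ add
  rintro _ ⟨θ, rfl⟩ n hn
  rw [ι_eq_oneForm]
  exact mul _ _ hn

theorem interiorProd_mem {p : ℕ} (v : V) :
    ∀ x ∈ ⋀[ℝ]^(p + 1) (Module.Dual ℝ V), interiorProd v x ∈ ⋀[ℝ]^p (Module.Dual ℝ V) := by
  induction p with
  | zero =>
    refine exteriorPower_succ_induction (fun x y hx hy => ?_) fun w x hx => ?_
    · rw [map_add]; exact add_mem hx hy
    · obtain ⟨r, rfl⟩ := mem_exteriorPower_zero.1 hx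
      rw [interiorProd_oneForm_mul, interiorProd_algebraMap, mul_zero, sub_zero]
      exact Submodule.smul_mem _ _ hx
  | succ p ih =>
    refine exteriorPower_succ_induction (fun x y hx hy => ?_) fun w x hx => ?_
    · rw [map_add]; exact add_mem hx hy
    · rw [interiorProd_oneForm_mul]
      exact sub_mem (Submodule.smul_mem _ _ hx) (oneForm_mul_mem _ (ih _ hx))

theorem interiorProd_eq_zero {x : Forms V} (v : V) (hx : x ∈ ⋀[ℝ]^0 (Module.Dual ℝ V)) :
    interiorProd v x = 0 := by
  obtain ⟨r, rfl⟩ := mem_exteriorPower_zero.1 hx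
  simp

/-- The interior product is a graded derivation. -/
theorem interiorProd_mul {p : ℕ} (v : V) (y : Forms V) :
    ∀ x ∈ ⋀[ℝ]^p (Module.Dual ℝ V), interiorProd v (x * y) =
      interiorProd v x * y + (-1 : ℝ) ^ p • (x * interiorProd v y) := by
  induction p with
  | zero =>
    intro x hx
    obtain ⟨r, rfl⟩ := mem_exteriorPower_zero.1 hx
    simp [← Algebra.smul_def]
  | succ p ih =>
    refine exteriorPower_succ_induction (fun x z hx hz => ?_) fun w x hx => ?_
    · simp only [add_mul, map_add, hx, hz, smul_add]; abel
    · simp only [mul_assoc, interiorProd_oneForm_mul, ih x hx, sub_mul, mul_add, pow_succ, smul_mul_assoc,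
        mul_smul_comm]
      module

theorem oneForm_mul_comm {p : ℕ} (v : V) :
    ∀ x ∈ ⋀[ℝ]^p (Module.Dual ℝ V), x * oneForm v = (-1 : ℝ) ^ p • (oneForm v * x) := by
  induction p with
  | zero =>
    intro x hx
    obtain ⟨r, rfl⟩ := mem_exteriorPower_zero.1 hx
    simp [Algebra.commutes]
  | succ p ih =>
    refine exteriorPower_succ_induction (fun x z hx hz => ?_) fun w x hx => ?_
    · simp only [add_mul, hx, hz, mul_add, smul_add]
    · have h : oneForm w * oneForm v = -(oneForm v * oneForm w) :=
        eq_neg_of_add_eq_zero_left (ExteriorAlgebra.ι_add_mul_swap _ _)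
      rw [mul_assoc, ih x hx, mul_smul_comm, ← mul_assoc, h, pow_succ, ← mul_assoc]
      simp

section ContractedWedge

@[simp] theorem contractedWedge_zero_right (k : ℕ) (α : Forms V) : contractedWedge k α 0 = 0 := by
  induction k generalizing α with
  | zero => simp [contractedWedge]
  | succ k ih => simp [contractedWedge, ih]

@[simp] theorem contractedWedge_zero_left (k : ℕ) (α : Forms V) : contractedWedge k 0 α = 0 := by
  induction k generalizing α with
  | zero => simp [contractedWedge]
  | succ k ih => simp [contractedWedge, ih]

theorem contractedWedge_add_left (k : ℕ) (α α' β : Forms V) :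
    contractedWedge k (α + α') β = contractedWedge k α β + contractedWedge k α' β := by
  induction k generalizing α α' β with
  | zero => simp [contractedWedge, add_mul]
  | succ k ih => simp [contractedWedge, ih, Finset.sum_add_distrib]

theorem contractedWedge_add_right (k : ℕ) (α β β' : Forms V) :
    contractedWedge k α (β + β') = contractedWedge k α β + contractedWedge k α β' := by
  induction k generalizing α β β' with
  | zero => simp [contractedWedge, mul_add]
  | succ k ih => simp [contractedWedge, ih, Finset.sum_add_distrib]

theorem contractedWedge_smul_left (k : ℕ) (c : ℝ) (α β : Forms V) :
    contractedWedge k (c • α) β = c • contractedWedge k α β := by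
  induction k generalizing α β with
  | zero => simp [contractedWedge]
  | succ k ih => simp [contractedWedge, ih, Finset.smul_sum]

theorem contractedWedge_smul_right (k : ℕ) (c : ℝ) (α β : Forms V) :
    contractedWedge k α (c • β) = c • contractedWedge k α β := by
  induction k generalizing α β with
  | zero => simp [contractedWedge]
  | succ k ih => simp [contractedWedge, ih, Finset.smul_sum]

theorem contractedWedge_sum_right {ι : Type*} (s : Finset ι) (k : ℕ) (α : Forms V)
    (f : ι → Forms V) :
    contractedWedge k α (∑ i ∈ s, f i) = ∑ i ∈ s, contractedWedge k α (f i) :=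
  map_sum (AddMonoidHom.mk' (contractedWedge k α) (contractedWedge_add_right k α)) f s

theorem contractedWedge_sub_left (k : ℕ) (α α' β : Forms V) :
    contractedWedge k (α - α') β = contractedWedge k α β - contractedWedge k α' β :=
  map_sub (AddMonoidHom.mk' (contractedWedge k · β) fun x y => contractedWedge_add_left k x y β) α α'

theorem contractedWedge_neg_right (k : ℕ) (α β : Forms V) :
    contractedWedge k α (-β) = -contractedWedge k α β := by
  simpa using contractedWedge_smul_right k (-1) α β

theorem sum_inner_smul_contractedWedge (k : ℕ) (v : V) (α β : Forms V) :
    ∑ i, ⟪v, stdOrthonormalBasis ℝ V i⟫_ℝ •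
      contractedWedge k α (interiorProd (stdOrthonormalBasis ℝ V i) β) =
      contractedWedge k α (interiorProd v β) := by
  conv_rhs => rw [← (stdOrthonormalBasis ℝ V).sum_repr' v, interiorProd_sum_left,
    contractedWedge_sum_right]
  refine Finset.sum_congr rfl fun i _ => ?_
  rw [interiorProd_smul_left, contractedWedge_smul_right, real_inner_comm]

/-- Each of the `k + 1` contractions either passes `v`, changing the sign, or hits it. Interior
products anticommute, so the `k + 1` ways of hitting `v` contribute equal terms. -/
theorem contractedWedge_oneForm_mul (k : ℕ) (v : V) (α β : Forms V) :
    contractedWedge (k + 1) (oneForm v * α) β =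
      (-1 : ℝ) ^ (k + 1) • (oneForm v * contractedWedge (k + 1) α β) +
        (k + 1 : ℝ) • contractedWedge k α (interiorProd v β) := by
  induction k generalizing α β with
  | zero =>
    simp only [contractedWedge, interiorProd_oneForm_mul, sub_mul, Finset.sum_sub_distrib]
    have := sum_inner_smul_contractedWedge 0 v α β
    simp only [contractedWedge] at this
    simp [← this, Finset.mul_sum, mul_assoc]
    abel
  | succ k ih =>
    rw [contractedWedge]
    simp only [interiorProd_oneForm_mul, contractedWedge_sub_left, contractedWedge_smul_left,
      Finset.sum_sub_distrib, sum_inner_smul_contractedWedge, ih]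
    simp only [interiorProd_comm v, contractedWedge_neg_right, Finset.sum_add_distrib,
      ← Finset.smul_sum, ← Finset.mul_sum, Finset.sum_neg_distrib]
    have hk : ∀ β' : Forms V, ∑ i, contractedWedge k (interiorProd (stdOrthonormalBasis ℝ V i) α)
        (interiorProd (stdOrthonormalBasis ℝ V i) β') = contractedWedge (k + 1) α β' :=
      fun _ => rfl
    have hk' : ∑ i, contractedWedge (k + 1) (interiorProd (stdOrthonormalBasis ℝ V i) α)
        (interiorProd (stdOrthonormalBasis ℝ V i) β) = contractedWedge (k + 2) α β := rfl
    rw [hk, hk', pow_succ _ (k + 1)]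
    push_cast
    module

theorem contractedWedge_eq_zero {p k : ℕ} (h : p < k) {α : Forms V}
    (hα : α ∈ ⋀[ℝ]^p (Module.Dual ℝ V)) (β : Forms V) : contractedWedge k α β = 0 := by
  induction k generalizing p α β with
  | zero => omega
  | succ k ih =>
    refine Finset.sum_eq_zero fun i _ => ?_
    cases p with
    | zero => simp [interiorProd_eq_zero _ hα]
    | succ p => exact ih (by omega) (interiorProd_mem _ _ hα) _

theorem contractedWedge_mem {p q k : ℕ} {α β : Forms V}
    (hα : α ∈ ⋀[ℝ]^(p + k) (Module.Dual ℝ V)) (hβ : β ∈ ⋀[ℝ]^(q + k) (Module.Dual ℝ V)) :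
    contractedWedge k α β ∈ ⋀[ℝ]^(p + q) (Module.Dual ℝ V) := by
  induction k generalizing α β with
  | zero => exact mul_mem_exteriorPower hα hβ
  | succ k ih =>
    exact sum_mem fun i _ => ih (interiorProd_mem _ _ hα) (interiorProd_mem _ _ hβ)

/-- The graded Leibniz rule: passing the `k` contractions costs `(-1)^k` in either factor, and
passing what is left of `α` costs a further `(-1)^(p-k)` in the second. -/
theorem interiorProd_contractedWedge {p k : ℕ} (v : V) {α : Forms V}
    (hα : α ∈ ⋀[ℝ]^p (Module.Dual ℝ V)) (β : Forms V) :
    interiorProd v (contractedWedge k α β) =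
      (-1 : ℝ) ^ k • contractedWedge k (interiorProd v α) β +
        (-1 : ℝ) ^ p • contractedWedge k α (interiorProd v β) := by
  induction k generalizing p α β with
  | zero => simp [contractedWedge, interiorProd_mul v β α hα]
  | succ k ih =>
    cases p with
    | zero =>
      rw [contractedWedge_eq_zero (by omega) hα, contractedWedge_eq_zero (by omega) hα,
        interiorProd_eq_zero v hα]
      simp
    | succ p =>
      have neg_left : ∀ x y : Forms V, contractedWedge k (-x) y = -contractedWedge k x y :=
        fun x y => by simpa using contractedWedge_smul_left k (-1) x y
      rw [contractedWedge, map_sum]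
      simp only [ih (interiorProd_mem _ _ hα), interiorProd_comm v, neg_left,
        contractedWedge_neg_right]
      simp only [Finset.sum_add_distrib, ← Finset.smul_sum, Finset.sum_neg_distrib]
      rw [← contractedWedge, ← contractedWedge, pow_succ _ k, pow_succ _ p]
      module

end ContractedWedge

end ExteriorCalculus

/-! ### The Chevalley–Riesz map and the Clifford product. -/

section Quantization

variable {V : Type*} [NormedAddCommGroup V] [InnerProductSpace ℝ V] [FiniteDimensional ℝ V]

variable (V) in
/-- The real Chevalley-Riesz isomorphism from exterior forms to the Clifford algebra. -/
def quant : Forms V ≃ₗ[ℝ] CliffordAlgebra (dualQuadraticForm V) :=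
  (CliffordAlgebra.equivExterior (dualQuadraticForm V)).symm

/-- The Clifford algebra element of the one-form dual to a vector. -/
def gen (v : V) : CliffordAlgebra (dualQuadraticForm V) :=
  CliffordAlgebra.ι (dualQuadraticForm V) (flat V v)

theorem dualMetric_flat (v w : V) : dualMetric V (flat V v) (flat V w) = ⟪v, w⟫_ℝ := by
  simp [dualMetric, sharp]

@[simp] theorem quant_algebraMap (r : ℝ) : quant V (algebraMap ℝ _ r) = algebraMap ℝ _ r :=
  CliffordAlgebra.changeForm_algebraMap
    (CliffordAlgebra.changeForm.neg_proof CliffordAlgebra.changeForm.associated_neg_proof) _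

@[simp] theorem quant_one : quant V 1 = 1 :=
  CliffordAlgebra.changeForm_one
    (CliffordAlgebra.changeForm.neg_proof CliffordAlgebra.changeForm.associated_neg_proof)

theorem quant_oneForm (v : V) : quant V (oneForm v) = gen v :=
  CliffordAlgebra.changeForm_ι
    (CliffordAlgebra.changeForm.neg_proof CliffordAlgebra.changeForm.associated_neg_proof) _

theorem quant_oneForm_mul (v : V) (x : Forms V) :
    quant V (oneForm v * x) = gen v * quant V x - quant V (interiorProd v x) := by
  refine (CliffordAlgebra.changeForm_ι_mul
    (CliffordAlgebra.changeForm.neg_proof CliffordAlgebra.changeForm.associated_neg_proof) _ _).trans ?_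
  -- It remains to identify the bilinear form contracted by the change of form: by polarization of
  -- `h*` it is contraction with `v`.
  congr 1
  refine ((CliffordAlgebra.changeForm_contractLeft _ _ _).symm.trans ?_)
  refine congrArg (fun d => quant V (CliffordAlgebra.contractLeft (Q := 0) d x)) ?_
  refine LinearMap.ext fun θ => ?_
  obtain ⟨w, rfl⟩ := (flat V).surjective θ
  have hs : ∀ a b, dualMetric V a b = dualMetric V b a := fun a b => by
    simp [dualMetric, real_inner_comm]
  simp [dualQuadraticForm, QuadraticMap.associated_apply, Module.Dual.eval_apply, hs (flat V w)]
  rw [dualMetric_flat v w, real_inner_comm v w]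
  ring

theorem gen_mul_quant (v : V) (x : Forms V) :
    gen v * quant V x = quant V (oneForm v * x) + quant V (interiorProd v x) := by
  rw [quant_oneForm_mul]; abel

/-- The coefficients in the expansion of the Clifford product of a `p`-form and another form. -/
def wedgeCoeff (p k : ℕ) : ℝ := (-1) ^ (k * (k + 1) / 2 + p * k) / k.factorial

theorem wedgeCoeff_zero_right (p : ℕ) : wedgeCoeff p 0 = 1 := by simp [wedgeCoeff]

theorem wedgeCoeff_succ_left (p k : ℕ) : wedgeCoeff (p + 1) k = (-1) ^ k * wedgeCoeff p k := by
  simp only [wedgeCoeff, add_mul, one_mul, ← add_assoc, pow_add]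
  ring

/-- With `wedgeCoeff_succ_left`, this recursion mirrors the two terms of
`contractedWedge_oneForm_mul`, as the induction for the Clifford product requires. -/
theorem wedgeCoeff_succ_succ (p k : ℕ) :
    wedgeCoeff (p + 1) (k + 1) * (k + 1) = (-1) ^ p * wedgeCoeff p k := by
  have h1 : (k + 1) * (k + 1 + 1) / 2 = k * (k + 1) / 2 + (k + 1) := by
    have : (k + 1) * (k + 1 + 1) = k * (k + 1) + 2 * (k + 1) := by ring
    omega
  have h2 : (-1 : ℝ) ^ ((k + 1) * (k + 1 + 1) / 2 + (p + 1) * (k + 1)) =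
      (-1) ^ p * (-1) ^ (k * (k + 1) / 2 + p * k) := by
    rw [h1, ← pow_add, show k * (k + 1) / 2 + (k + 1) + (p + 1) * (k + 1) =
      (p + (k * (k + 1) / 2 + p * k)) + 2 * (k + 1) by ring, pow_add _ _ (2 * (k + 1))]
    simp
  have h3 : (k.factorial : ℝ) ≠ 0 := by positivity
  have h4 : (k + 1 : ℝ) ≠ 0 := by positivity
  rw [wedgeCoeff, wedgeCoeff, h2, Nat.factorial_succ]
  push_cast
  field_simp

/-- The Clifford product in terms of contracted wedge products. -/
theorem quant_mul_quant {p n : ℕ} (h : p < n) {α : Forms V}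
    (hα : α ∈ ⋀[ℝ]^p (Module.Dual ℝ V)) (β : Forms V) :
    quant V α * quant V β =
      ∑ k ∈ Finset.range n, wedgeCoeff p k • quant V (contractedWedge k α β) := by
  -- The bound `n` stays free, since summands beyond the degree vanish: `x` and `ι_v x`, of
  -- different degrees, can then share one range. Strong induction is needed because both occur.
  induction p using Nat.strong_induction_on generalizing n α β with
  | _ p ih =>
  obtain ⟨m, rfl⟩ : ∃ m, n = m + 1 := ⟨n - 1, by omega⟩
  cases p with
  | zero =>
    rw [Finset.sum_range_succ', Finset.sum_eq_zero fun k _ => by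
      rw [contractedWedge_eq_zero (by omega) hα, map_zero, smul_zero]]
    obtain ⟨r, rfl⟩ := mem_exteriorPower_zero.1 hα
    simp [wedgeCoeff_zero_right, contractedWedge, ← Algebra.smul_def]
  | succ p =>
    revert hα
    generalize α = a
    revert a
    refine exteriorPower_succ_induction (fun x y hx hy => ?_) fun v x hx => ?_
    · simp only [map_add, add_mul, hx, hy, contractedWedge_add_left, smul_add,
        Finset.sum_add_distrib]
    · have e1 : quant V (interiorProd v x) * quant V β = ∑ k ∈ Finset.range (m + 1),
          ((-1) ^ k * wedgeCoeff p k) • quant V (contractedWedge k (interiorProd v x) β) := by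
        cases p with
        | zero => simp [interiorProd_eq_zero v hx]
        | succ p =>
          rw [ih p (by omega) (n := m + 1) (by omega) (interiorProd_mem _ _ hx)]
          refine Finset.sum_congr rfl fun k _ => ?_
          rw [wedgeCoeff_succ_left, ← mul_assoc, ← mul_pow]
          simp
      have e2 : ∀ k, gen v * quant V (contractedWedge k x β) =
          quant V (oneForm v * contractedWedge k x β) +
          ((-1 : ℝ) ^ k • quant V (contractedWedge k (interiorProd v x) β) +
            (-1 : ℝ) ^ p • quant V (contractedWedge k x (interiorProd v β))) := fun k => by
        rw [gen_mul_quant, interiorProd_contractedWedge v hx, map_add, map_smul, map_smul]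
      have e3 : quant V x * quant V β = ∑ k ∈ Finset.range (m + 1),
          wedgeCoeff p k • quant V (contractedWedge k x β) := ih p (by omega) (by omega) hx β
      -- The contractions against `ι_v β` arrive with index shifted by one; the top term `k = m`
      -- vanishes because `p < m`, so the ranges agree. The terms containing `ι_v x` in `e1` and
      -- `e2` then cancel.
      have e4 : ∑ k ∈ Finset.range (m + 1),
          wedgeCoeff (p + 1) k • quant V (contractedWedge k (oneForm v * x) β) =
          ∑ k ∈ Finset.range (m + 1),
            wedgeCoeff p k • quant V (oneForm v * contractedWedge k x β) +
          ∑ k ∈ Finset.range (m + 1), ((-1) ^ p * wedgeCoeff p k) •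
            quant V (contractedWedge k x (interiorProd v β)) := by
        rw [Finset.sum_range_succ (fun k => ((-1) ^ p * wedgeCoeff p k) •
            quant V (contractedWedge k x (interiorProd v β))) m, contractedWedge_eq_zero (k := m) (by omega) hx (interiorProd v β),
          map_zero, smul_zero, add_zero, Finset.sum_range_succ', Finset.sum_range_succ' _ m,
          add_right_comm, ← Finset.sum_add_distrib]
        congr 1
        · refine Finset.sum_congr rfl fun k _ => ?_
          rw [contractedWedge_oneForm_mul, map_add, map_smul, map_smul, smul_add, smul_smul,
            smul_smul, wedgeCoeff_succ_succ, wedgeCoeff_succ_left, mul_right_comm, ← mul_pow]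
          simp
        · simp [wedgeCoeff_zero_right, contractedWedge, mul_assoc]
      rw [quant_oneForm_mul, sub_mul, mul_assoc, e1, e3, e4, Finset.mul_sum]
      simp only [mul_smul_comm, e2, ← Finset.sum_add_distrib, ← Finset.sum_sub_distrib]
      refine Finset.sum_congr rfl fun k _ => ?_
      module

theorem quant_mul_gen {p : ℕ} (v : V) {α : Forms V} (hα : α ∈ ⋀[ℝ]^p (Module.Dual ℝ V)) :
    quant V α * gen v = (-1 : ℝ) ^ p • quant V (oneForm v * α - interiorProd v α) := by
  induction p using Nat.strong_induction_on generalizing α with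
  | _ p ih =>
  cases p with
  | zero =>
    obtain ⟨r, rfl⟩ := mem_exteriorPower_zero.1 hα
    simp [← Algebra.commutes, ← Algebra.smul_def, quant_oneForm]
  | succ p =>
    revert hα
    generalize α = a
    revert a
    refine exteriorPower_succ_induction (fun x y hx hy => ?_) fun w x hx => ?_
    · simp only [map_add, add_mul, hx, hy, mul_add, map_sub, smul_sub, smul_add]; abel
    · have e1 : quant V (interiorProd w x) * gen v = (-1 : ℝ) ^ (p + 1) •
          quant V (oneForm v * interiorProd w x - interiorProd v (interiorProd w x)) := by
        cases p with
        | zero => simp [interiorProd_eq_zero w hx]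
        | succ p =>
          rw [ih p (by omega) (interiorProd_mem _ _ hx), pow_succ, pow_succ]
          simp
      have h : oneForm w * oneForm v = -(oneForm v * oneForm w) :=
        eq_neg_of_add_eq_zero_left (ExteriorAlgebra.ι_add_mul_swap _ _)
      rw [quant_oneForm_mul, sub_mul, mul_assoc, ih p (by omega) hx, e1, mul_smul_comm,
        gen_mul_quant]
      simp only [map_sub, interiorProd_oneForm_mul, ← mul_assoc, mul_sub, h, pow_succ,
        interiorProd_comm v w, neg_mul, map_neg, map_smul, real_inner_comm v w]
      module

/-- Left and right multiplication by `v` differ only in the sign of the contraction, so exterior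
multiplication is half a graded commutator. This reduces statements on reversion, the volume element
and traces to generators. -/
theorem two_smul_quant_oneForm_mul {p : ℕ} (v : V) {α : Forms V}
    (hα : α ∈ ⋀[ℝ]^p (Module.Dual ℝ V)) :
    (2 : ℝ) • quant V (oneForm v * α) =
      gen v * quant V α + (-1 : ℝ) ^ p • (quant V α * gen v) := by
  rw [gen_mul_quant, quant_mul_gen v hα, smul_smul, ← mul_pow, map_sub]
  simp only [neg_mul_neg, one_mul, one_pow]
  module

/-- The sign of the reversion on `p`-forms. -/
def revSign (p : ℕ) : ℝ := (-1) ^ (p * (p - 1) / 2)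

theorem revSign_succ (p : ℕ) : revSign (p + 1) = (-1) ^ p * revSign p := by
  rw [revSign, revSign, Nat.triangle_succ, pow_add, mul_comm]

theorem reverse_quant {p : ℕ} : ∀ α ∈ ⋀[ℝ]^p (Module.Dual ℝ V),
    CliffordAlgebra.reverse (quant V α) = revSign p • quant V α := by
  induction p with
  | zero =>
    intro α hα
    obtain ⟨r, rfl⟩ := mem_exteriorPower_zero.1 hα
    simp [revSign]
  | succ p ih =>
    refine exteriorPower_succ_induction (fun x y hx hy => ?_) fun v x hx => ?_
    · simp only [map_add, hx, hy, smul_add]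
    · have h2 : (2 : ℝ) • CliffordAlgebra.reverse (quant V (oneForm v * x)) =
          (2 : ℝ) • (revSign (p + 1) • quant V (oneForm v * x)) := by
        rw [smul_comm (2 : ℝ), ← map_smul, two_smul_quant_oneForm_mul v hx]
        simp only [map_add, map_smul, CliffordAlgebra.reverse.map_mul, ih x hx, gen,
          CliffordAlgebra.reverse_ι, revSign_succ, smul_add, smul_smul, mul_smul_comm,
          smul_mul_assoc]
        rw [mul_right_comm, ← mul_pow]
        simp only [neg_mul_neg, one_mul, one_pow]
        abel
      exact (smul_right_injective _ (two_ne_zero (α := ℝ))) h2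

end Quantization

/-! ### Full contractions and the inner product of forms. -/

section Metric

variable {V : Type*} [NormedAddCommGroup V] [InnerProductSpace ℝ V] [FiniteDimensional ℝ V]

theorem multiContract_ι (θ : Module.Dual ℝ V) (x : Forms V) :
    (multiContract (ExteriorAlgebra.ι ℝ θ)).unop x = interiorProd (sharp V θ) x := by
  simp [multiContract, interiorProd]

theorem multiContract_oneForm_mul (v : V) (α x : Forms V) :
    (multiContract (oneForm v * α)).unop x = (multiContract α).unop (interiorProd v x) := by
  rw [map_mul, MulOpposite.unop_mul, Module.End.mul_apply, oneForm, multiContract_ι]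
  simp [sharp]

theorem multiContract_algebraMap (r : ℝ) (x : Forms V) :
    (multiContract (algebraMap ℝ (Forms V) r)).unop x = r • x := by
  rw [AlgHom.commutes]; simp [Algebra.algebraMap_eq_smul_one]

theorem multiContract_interiorProd {p : ℕ} (v : V) (x : Forms V) :
    ∀ α ∈ ⋀[ℝ]^p (Module.Dual ℝ V), (multiContract α).unop (interiorProd v x) =
      (-1 : ℝ) ^ p • interiorProd v ((multiContract α).unop x) := by
  induction p generalizing x with
  | zero =>
    intro α hα
    obtain ⟨r, rfl⟩ := mem_exteriorPower_zero.1 hα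
    simp [Algebra.algebraMap_eq_smul_one]
  | succ p ih =>
    refine exteriorPower_succ_induction (fun x y hx hy => ?_) fun w α hα => ?_
    · simp [hx, hy]
    · rw [multiContract_oneForm_mul, multiContract_oneForm_mul, interiorProd_comm, map_neg,
        ih _ _ hα, pow_succ]
      simp

theorem multiContract_mem {p q : ℕ} {x : Forms V} : x ∈ ⋀[ℝ]^(q + p) (Module.Dual ℝ V) →
    ∀ α ∈ ⋀[ℝ]^p (Module.Dual ℝ V), (multiContract α).unop x ∈ ⋀[ℝ]^q (Module.Dual ℝ V) := by
  induction p generalizing x with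
  | zero =>
    intro hx α hα
    obtain ⟨r, rfl⟩ := mem_exteriorPower_zero.1 hα
    rw [multiContract_algebraMap]
    exact Submodule.smul_mem _ _ hx
  | succ p ih =>
    intro hx
    refine exteriorPower_succ_induction (fun x y hx hy => ?_) fun w α hα => ?_
    · simpa using add_mem hx hy
    · rw [multiContract_oneForm_mul]
      exact ih (interiorProd_mem _ _ hx) _ hα

/-- Full contraction of two forms of the same degree. -/
theorem contractedWedge_eq_multiContract {k : ℕ} {β : Forms V} :
    β ∈ ⋀[ℝ]^k (Module.Dual ℝ V) → ∀ α ∈ ⋀[ℝ]^k (Module.Dual ℝ V),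
      contractedWedge k α β = (k.factorial : ℝ) • (multiContract α).unop β := by
  induction k generalizing β with
  | zero =>
    intro _ α hα
    obtain ⟨r, rfl⟩ := mem_exteriorPower_zero.1 hα
    rw [multiContract_algebraMap]
    simp [contractedWedge, Algebra.smul_def]
  | succ k ih =>
    intro hβ
    refine exteriorPower_succ_induction (fun x y hx hy => ?_) fun w α hα => ?_
    · simp [contractedWedge_add_left, hx, hy]
    · rw [contractedWedge_oneForm_mul, contractedWedge_eq_zero (by omega) hα,
        ih (interiorProd_mem _ _ hβ) _ hα, multiContract_oneForm_mul, Nat.factorial_succ, smul_smul]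
      simp

theorem interiorProd_ιMulti (v : V) {n : ℕ} (φ : Fin (n + 1) → Module.Dual ℝ V) :
    interiorProd v (ExteriorAlgebra.ιMulti ℝ (n + 1) φ) = ∑ j : Fin (n + 1),
      ((-1 : ℝ) ^ (j : ℕ) * φ j v) • ExteriorAlgebra.ιMulti ℝ n (φ ∘ j.succAbove) := by
  induction n with
  | zero =>
    rw [ExteriorAlgebra.ιMulti_succ_apply, interiorProd_ι_mul]
    simp
  | succ n ih =>
    rw [ExteriorAlgebra.ιMulti_succ_apply, interiorProd_ι_mul, ih,
      Fin.sum_univ_succ (n := n + 1), Finset.mul_sum, sub_eq_add_neg, ← Finset.sum_neg_distrib]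
    congr 1
    · simp [Matrix.vecTail, Function.comp_def]
    · refine Finset.sum_congr rfl fun j _ => ?_
      rw [ExteriorAlgebra.ιMulti_succ_apply (v := φ ∘ j.succ.succAbove)]
      have h : Matrix.vecTail (φ ∘ j.succ.succAbove) = Matrix.vecTail φ ∘ j.succAbove := by
        funext i; simp [Matrix.vecTail]
      rw [h]
      simp [Matrix.vecTail, pow_succ]

/-- Contracting with the first one-form is the Laplace expansion of the Gram determinant along its
first row. -/
theorem multiContract_ιMulti {n : ℕ} (θ φ : Fin n → Module.Dual ℝ V) :
    (multiContract (ExteriorAlgebra.ιMulti ℝ n θ)).unop (ExteriorAlgebra.ιMulti ℝ n φ) =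
      algebraMap ℝ (Forms V) (Matrix.of fun i j => φ j (sharp V (θ i))).det := by
  induction n with
  | zero => simp
  | succ n ih =>
    rw [ExteriorAlgebra.ιMulti_succ_apply, ι_eq_oneForm, multiContract_oneForm_mul,
      interiorProd_ιMulti, map_sum, Matrix.det_succ_row_zero, map_sum]
    refine Finset.sum_congr rfl fun j _ => ?_
    rw [map_smul, ih, Algebra.smul_def, ← map_mul]
    rfl

/-- The inner product of forms is given by full contraction. -/
theorem algebraMap_formInner (k : ℕ) (α β : ⋀[ℝ]^k (Module.Dual ℝ V)) :
    algebraMap ℝ (Forms V) (formInner k α β) = (multiContract (β : Forms V)).unop (α : Forms V) := by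
  have hα : α ∈ Submodule.span ℝ (Set.range (exteriorPower.ιMulti ℝ k (M := Module.Dual ℝ V))) := by
    rw [exteriorPower.ιMulti_span]; trivial
  have hβ : β ∈ Submodule.span ℝ (Set.range (exteriorPower.ιMulti ℝ k (M := Module.Dual ℝ V))) := by
    rw [exteriorPower.ιMulti_span]; trivial
  unfold formInner
  induction hα using Submodule.span_induction with
  | zero => simp
  | add x y _ _ hx hy => simp [hx, hy]
  | smul c x _ hx => simp only [map_smul, LinearMap.smul_apply, SetLike.val_smul, ← hx]; simp [Algebra.smul_def]
  | mem x hx =>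
    obtain ⟨φ, rfl⟩ := hx
    induction hβ using Submodule.span_induction with
    | zero => simp
    | add x y _ _ hx hy => simp [hx, hy]
    | smul c x _ hx => simp only [map_smul, LinearMap.smul_apply, SetLike.val_smul, MulOpposite.unop_smul, ← hx]; simp [Algebra.smul_def]
    | mem y hy =>
      obtain ⟨θ, rfl⟩ := hy
      rw [exteriorPower.map_apply_ιMulti, exteriorPower.pairingDual_ιMulti_ιMulti,
        exteriorPower.ιMulti_apply_coe, exteriorPower.ιMulti_apply_coe, multiContract_ιMulti]
      rfl

end Metric

/-! ### Homogeneous components and products of forms of degrees two and four. -/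

section Grading

variable {V : Type*} [NormedAddCommGroup V] [InnerProductSpace ℝ V] [FiniteDimensional ℝ V]

/-- The projection of a form onto its component of degree `p`. -/
def degPart (p : ℕ) : Forms V →ₗ[ℝ] Forms V :=
  GradedAlgebra.proj (fun i : ℕ => ⋀[ℝ]^i (Module.Dual ℝ V)) p

theorem degPart_mem (p : ℕ) (x : Forms V) : degPart p x ∈ ⋀[ℝ]^p (Module.Dual ℝ V) :=
  SetLike.coe_mem (DirectSum.decompose (fun i : ℕ => ⋀[ℝ]^i (Module.Dual ℝ V)) x p)

theorem degPart_of_mem {p : ℕ} {x : Forms V} (hx : x ∈ ⋀[ℝ]^p (Module.Dual ℝ V)) :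
    degPart p x = x :=
  DirectSum.decompose_of_mem_same (fun i : ℕ => ⋀[ℝ]^i (Module.Dual ℝ V)) hx

theorem degPart_of_mem_ne {p q : ℕ} {x : Forms V} (hx : x ∈ ⋀[ℝ]^p (Module.Dual ℝ V))
    (h : p ≠ q) : degPart q x = 0 :=
  DirectSum.decompose_of_mem_ne (fun i : ℕ => ⋀[ℝ]^i (Module.Dual ℝ V)) hx h

theorem forms_induction {P : Forms V → Prop} (add : ∀ x y, P x → P y → P (x + y))
    (hom : ∀ p, ∀ x ∈ ⋀[ℝ]^p (Module.Dual ℝ V), P x) (x : Forms V) : P x := by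
  induction x using DirectSum.Decomposition.inductionOn fun i => ⋀[ℝ]^i (Module.Dual ℝ V) with
  | zero => exact hom 0 0 (zero_mem _)
  | add x y hx hy => exact add x y hx hy
  | homogeneous x => exact hom _ _ x.2

/-- An operator acting by scalars on homogeneous forms commutes with the projections. -/
theorem degPart_apply_of_smul (T : Forms V →ₗ[ℝ] Forms V) (c : ℕ → ℝ)
    (hT : ∀ p, ∀ x ∈ ⋀[ℝ]^p (Module.Dual ℝ V), T x = c p • x) (p : ℕ) (x : Forms V) :
    degPart p (T x) = c p • degPart p x := by
  refine forms_induction (P := fun x => degPart p (T x) = c p • degPart p x)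
    (fun x y hx hy => by simp only [map_add, hx, hy, smul_add]) (fun q x hx => ?_) x
  rw [hT q x hx, map_smul]
  rcases eq_or_ne q p with rfl | h
  · rfl
  · rw [degPart_of_mem_ne hx h, smul_zero, smul_zero]

theorem mul_comm_exteriorPower {p q : ℕ} {y : Forms V} (hy : y ∈ ⋀[ℝ]^q (Module.Dual ℝ V)) :
    ∀ x ∈ ⋀[ℝ]^p (Module.Dual ℝ V), y * x = (-1 : ℝ) ^ (p * q) • (x * y) := by
  induction p with
  | zero =>
    intro x hx
    obtain ⟨r, rfl⟩ := mem_exteriorPower_zero.1 hx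
    simp [Algebra.commutes]
  | succ p ih =>
    refine exteriorPower_succ_induction (fun x z hx hz => ?_) fun v x hx => ?_
    · simp only [add_mul, mul_add, hx, hz, smul_add]
    · rw [← mul_assoc, oneForm_mul_comm v y hy, smul_mul_assoc, mul_assoc, ih x hx, mul_smul_comm,
        smul_smul, add_mul, one_mul, pow_add, mul_comm, mul_assoc]

theorem contractedWedge_comm {p q k : ℕ} {α β : Forms V}
    (hα : α ∈ ⋀[ℝ]^(p + k) (Module.Dual ℝ V)) (hβ : β ∈ ⋀[ℝ]^(q + k) (Module.Dual ℝ V)) :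
    contractedWedge k β α = (-1 : ℝ) ^ (p * q) • contractedWedge k α β := by
  induction k generalizing α β with
  | zero => exact mul_comm_exteriorPower hβ _ hα
  | succ k ih =>
    rw [contractedWedge, contractedWedge, Finset.smul_sum]
    exact Finset.sum_congr rfl fun i _ => ih (interiorProd_mem _ _ hα) (interiorProd_mem _ _ hβ)

theorem contractedWedge_eq_zero_right {p k : ℕ} (h : p < k) (α : Forms V) {β : Forms V}
    (hβ : β ∈ ⋀[ℝ]^p (Module.Dual ℝ V)) : contractedWedge k α β = 0 := by
  induction k generalizing p α β with
  | zero => omega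
  | succ k ih =>
    refine Finset.sum_eq_zero fun i _ => ?_
    cases p with
    | zero => simp [interiorProd_eq_zero _ hβ]
    | succ p => exact ih (by omega) _ (interiorProd_mem _ _ hβ)

theorem contractedWedge_self_eq_zero {p k : ℕ} (hp : Odd p) {α : Forms V}
    (hα : α ∈ ⋀[ℝ]^(p + k) (Module.Dual ℝ V)) : contractedWedge k α α = 0 := by
  have h := contractedWedge_comm hα hα
  rw [(hp.mul hp).neg_one_pow, neg_one_smul] at h
  have h2 : (2 : ℝ) • contractedWedge k α α = 0 := by
    rw [two_smul]; nth_rewrite 1 [h]; exact neg_add_cancel _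
  exact (smul_eq_zero.1 h2).resolve_left two_ne_zero

theorem contractedWedge_full (k : ℕ) (α : ⋀[ℝ]^k (Module.Dual ℝ V)) :
    contractedWedge k (α : Forms V) (α : Forms V) =
      ((k.factorial : ℝ) * formInner k α α) • (1 : Forms V) := by
  rw [contractedWedge_eq_multiContract α.2 _ α.2, ← algebraMap_formInner,
    Algebra.algebraMap_eq_smul_one, smul_smul]

/-- The single contraction leaves one index in each factor, so it is antisymmetric and drops out of
a square; only the wedge product and the full contraction remain. -/
theorem quant_mul_self_two (ω : ⋀[ℝ]^2 (Module.Dual ℝ V)) :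
    quant V ω * quant V ω = quant V ((ω : Forms V) * ω) - formInner 2 ω ω • 1 := by
  rw [quant_mul_quant (n := 3) (by norm_num) ω.2]
  simp only [Finset.sum_range_succ, Finset.sum_range_zero, contractedWedge_full,
    contractedWedge_self_eq_zero (p := 1) (k := 1) (by decide) ω.2, map_smul, quant_one, map_zero]
  rw [contractedWedge.eq_1]
  simp only [wedgeCoeff]
  norm_num [Nat.factorial]
  module

theorem quant_mul_self_four (Θ : ⋀[ℝ]^4 (Module.Dual ℝ V)) :
    quant V Θ * quant V Θ = quant V ((Θ : Forms V) * Θ) - quant V (genProduct 2 (Θ : Forms V) Θ) +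
      formInner 4 Θ Θ • 1 := by
  rw [quant_mul_quant (n := 5) (by norm_num) Θ.2]
  simp only [Finset.sum_range_succ, Finset.sum_range_zero, contractedWedge_full, genProduct,
    contractedWedge_self_eq_zero (p := 1) (k := 3) (by decide) Θ.2,
    contractedWedge_self_eq_zero (p := 3) (k := 1) (by decide) Θ.2, map_smul, quant_one, map_zero]
  rw [contractedWedge.eq_1]
  simp only [wedgeCoeff]
  norm_num [Nat.factorial]
  module

/-- Exchanging the factors changes the sign of the single contraction only, so the anticommutator
keeps the terms with no or two contractions. -/
theorem quant_anticommutator (ω : ⋀[ℝ]^2 (Module.Dual ℝ V)) (Θ : ⋀[ℝ]^4 (Module.Dual ℝ V)) :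
    quant V ω * quant V Θ + quant V Θ * quant V ω =
      (2 : ℝ) • quant V ((ω : Forms V) * Θ) - quant V (contractedWedge 2 (ω : Forms V) Θ) := by
  rw [quant_mul_quant (n := 3) (by norm_num) ω.2, quant_mul_quant (n := 5) (by norm_num) Θ.2]
  simp only [Finset.sum_range_succ, Finset.sum_range_zero,
    contractedWedge_eq_zero_right (k := 3) (by norm_num) (Θ : Forms V) ω.2,
    contractedWedge_eq_zero_right (k := 4) (by norm_num) (Θ : Forms V) ω.2,
    contractedWedge_comm (p := 2) (q := 4) (k := 0) ω.2 Θ.2,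
    contractedWedge_comm (p := 1) (q := 3) (k := 1) ω.2 Θ.2,
    contractedWedge_comm (p := 0) (q := 2) (k := 2) ω.2 Θ.2, map_smul, map_zero]
  rw [contractedWedge.eq_1]
  simp only [wedgeCoeff]
  norm_num [Nat.factorial]
  module

end Grading

/-! ### The volume element and the Hodge star. -/

section Volume

variable {V : Type*} [NormedAddCommGroup V] [InnerProductSpace ℝ V] [FiniteDimensional ℝ V]
  [hV : Fact (Module.finrank ℝ V = 8)] (o : Orientation ℝ V (Fin 8))

theorem exteriorPower_eq_zero {p : ℕ} (hp : 8 < p) {x : Forms V}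
    (hx : x ∈ ⋀[ℝ]^p (Module.Dual ℝ V)) : x = 0 := by
  have h : Module.finrank ℝ (⋀[ℝ]^p (Module.Dual ℝ V)) = 0 := by
    rw [exteriorPower.finrank_eq, Subspace.dual_finrank_eq, hV.out, Nat.choose_eq_zero_of_lt hp]
  rw [Submodule.finrank_eq_zero] at h
  rwa [h, Submodule.mem_bot] at hx

theorem sum_degPart (x : Forms V) : ∑ p ∈ Finset.range 9, degPart p x = x := by
  refine forms_induction (P := fun x => ∑ p ∈ Finset.range 9, degPart p x = x)
    (fun x y hx hy => by simp only [map_add, Finset.sum_add_distrib, hx, hy]) (fun q x hx => ?_) x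
  by_cases hq : 8 < q
  · simp [exteriorPower_eq_zero hq hx]
  · rw [Finset.sum_eq_single q (fun b _ hb => degPart_of_mem_ne hx hb.symm)
      (fun h => absurd (Finset.mem_range.2 (by omega)) h), degPart_of_mem hx]

theorem volForm_mem : volForm o ∈ ⋀[ℝ]^8 (Module.Dual ℝ V) :=
  ExteriorAlgebra.ιMulti_range ℝ 8 ⟨_, rfl⟩

theorem oneForm_mul_volForm (v : V) : oneForm v * volForm o = 0 :=
  exteriorPower_eq_zero (by norm_num) (oneForm_mul_mem v (volForm_mem o))

theorem hodge_volForm : hodge o (volForm o) = 1 := by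
  rw [hodge, volForm, multiContract_ιMulti]
  have : (Matrix.of fun i j => (flat V) (o.finOrthonormalBasis (by norm_num) hV.out j)
      (sharp V ((flat V) (o.finOrthonormalBasis (by norm_num) hV.out i)))) =
      (1 : Matrix (Fin 8) (Fin 8) ℝ) := by
    ext i j
    simp only [Matrix.of_apply, sharp, LinearEquiv.symm_apply_apply, flat_apply]
    rw [real_inner_comm, orthonormal_iff_ite.1 (OrthonormalBasis.orthonormal _), Matrix.one_apply]
  rw [this, Matrix.det_one, map_one]

theorem hodge_add (α β : Forms V) : hodge o (α + β) = hodge o α + hodge o β := by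
  simp [hodge]

theorem hodge_smul (c : ℝ) (α : Forms V) : hodge o (c • α) = c • hodge o α := by
  simp [hodge]

theorem hodge_mem {p q : ℕ} (h : q + p = 8) {α : Forms V} (hα : α ∈ ⋀[ℝ]^p (Module.Dual ℝ V)) :
    hodge o α ∈ ⋀[ℝ]^q (Module.Dual ℝ V) :=
  multiContract_mem (by rw [h]; exact volForm_mem o) α hα

/-- The volume form as an element of the Clifford algebra. -/
def vol : CliffordAlgebra (dualQuadraticForm V) := quant V (volForm o)

theorem gen_mul_vol (v : V) : gen v * vol o = quant V (interiorProd v (volForm o)) := by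
  rw [vol, gen_mul_quant, oneForm_mul_volForm, map_zero, zero_add]

theorem vol_mul_gen (v : V) : vol o * gen v = -(gen v * vol o) := by
  rw [gen_mul_vol, vol, quant_mul_gen v (volForm_mem o), oneForm_mul_volForm]
  norm_num

theorem vol_mul_quant {p : ℕ} : ∀ α ∈ ⋀[ℝ]^p (Module.Dual ℝ V),
    vol o * quant V α = (-1 : ℝ) ^ p • (quant V α * vol o) := by
  induction p with
  | zero =>
    intro α hα
    obtain ⟨r, rfl⟩ := mem_exteriorPower_zero.1 hα
    simp [Algebra.commutes]
  | succ p ih =>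
    refine exteriorPower_succ_induction (fun x y hx hy => ?_) fun v x hx => ?_
    · simp only [map_add, mul_add, add_mul, hx, hy, smul_add]
    · have h2 : (2 : ℝ) • (vol o * quant V (oneForm v * x)) =
          (2 : ℝ) • ((-1 : ℝ) ^ (p + 1) • (quant V (oneForm v * x) * vol o)) := by
        rw [smul_comm (2 : ℝ), ← mul_smul_comm, ← smul_mul_assoc, two_smul_quant_oneForm_mul v hx,
          mul_add, add_mul, ← mul_assoc, vol_mul_gen, mul_smul_comm, ← mul_assoc, ih x hx, neg_mul,
          mul_assoc, ih x hx, smul_mul_assoc, smul_mul_assoc, mul_assoc (quant V x),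
          mul_assoc (quant V x), vol_mul_gen, pow_succ, mul_smul_comm, mul_assoc, mul_neg]
        module
      exact smul_right_injective _ (two_ne_zero (α := ℝ)) h2

/-- The volume element anticommutes with generators, so multiplying by it turns the graded
commutator that represents `v ∧` into the one that represents `ι_v`. Reordering `ι_v` past the
earlier contractions produces the reversion sign. -/
theorem quant_mul_vol {p q : ℕ} (h : q + p = 8) : ∀ α ∈ ⋀[ℝ]^p (Module.Dual ℝ V),
    quant V α * vol o = revSign p • quant V (hodge o α) := by
  induction p generalizing q with
  | zero =>
    intro α hα
    obtain ⟨r, rfl⟩ := mem_exteriorPower_zero.1 hα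
    rw [hodge, multiContract_algebraMap, map_smul, quant_algebraMap, ← Algebra.smul_def, vol]
    simp [revSign]
  | succ p ih =>
    refine exteriorPower_succ_induction (fun x y hx hy => ?_) fun v x hx => ?_
    · simp only [map_add, add_mul, hx, hy, smul_add, hodge_add]
    · have hm : hodge o x ∈ ⋀[ℝ]^(q + 1) (Module.Dual ℝ V) := hodge_mem o (by omega) hx
      have hs : (-1 : ℝ) ^ (q + 1) = (-1 : ℝ) ^ p := by
        have : (-1 : ℝ) ^ (q + 1) * (-1 : ℝ) ^ p = 1 := by
          rw [← pow_add, show q + 1 + p = 8 by omega]; norm_num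
        rcases neg_one_pow_eq_or ℝ p with h' | h' <;> rw [h'] at this ⊢ <;> linarith
      have e1 : gen v * quant V x * vol o = revSign p • (gen v * quant V (hodge o x)) := by
        rw [mul_assoc, ih (q := q + 1) (by omega) x hx, mul_smul_comm]
      have e2 : quant V x * gen v * vol o = -(revSign p • (quant V (hodge o x) * gen v)) := by
        rw [mul_assoc, ← neg_neg (gen v * vol o), ← vol_mul_gen, mul_neg, ← mul_assoc,
          ih (q := q + 1) (by omega) x hx, smul_mul_assoc]
      have e3 : hodge o (oneForm v * x) = (-1 : ℝ) ^ p • interiorProd v (hodge o x) := by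
        rw [hodge, multiContract_oneForm_mul, multiContract_interiorProd v _ x hx, ← hodge]
      have h2 : (2 : ℝ) • (quant V (oneForm v * x) * vol o) =
          (2 : ℝ) • (revSign (p + 1) • quant V (hodge o (oneForm v * x))) := by
        rw [← smul_mul_assoc, two_smul_quant_oneForm_mul v hx, add_mul, smul_mul_assoc, e1, e2, e3,
          gen_mul_quant, quant_mul_gen v hm, hs, revSign_succ, map_smul, map_sub]
        rcases neg_one_pow_eq_or ℝ p with h' | h' <;> rw [h'] <;> module
      exact smul_right_injective _ (two_ne_zero (α := ℝ)) h2

theorem vol_mul_vol : vol o * vol o = 1 := by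
  have h := quant_mul_vol o (q := 0) (by norm_num) _ (volForm_mem o)
  rw [hodge_volForm, quant_one] at h
  rw [vol] at h ⊢
  rw [h]
  norm_num [revSign]

end Volume

/-! ### The Clifford equation as a quadratic system. -/

section QuadraticSystem

variable {V : Type*} [NormedAddCommGroup V] [InnerProductSpace ℝ V] [FiniteDimensional ℝ V]
  [hV : Fact (Module.finrank ℝ V = 8)] (o : Orientation ℝ V (Fin 8))

theorem quant_volForm : quant V (volForm o) = vol o := rfl

theorem one_mem_exteriorPower : (1 : Forms V) ∈ ⋀[ℝ]^0 (Module.Dual ℝ V) :=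
  mem_exteriorPower_zero.2 ⟨1, map_one _⟩

theorem quant_two_mul_vol {ω : Forms V} (hω : ω ∈ ⋀[ℝ]^2 (Module.Dual ℝ V)) :
    quant V ω * vol o = -quant V (hodge o ω) := by
  rw [quant_mul_vol o (q := 6) (by norm_num) _ hω]; norm_num [revSign]

theorem quant_four_mul_vol {Θ : Forms V} (hΘ : Θ ∈ ⋀[ℝ]^4 (Module.Dual ℝ V)) :
    quant V Θ * vol o = quant V (hodge o Θ) := by
  rw [quant_mul_vol o (q := 4) (by norm_num) _ hΘ]; norm_num [revSign]

theorem quant_six_mul_vol {α : Forms V} (hα : α ∈ ⋀[ℝ]^6 (Module.Dual ℝ V)) :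
    quant V α * vol o = -quant V (hodge o α) := by
  rw [quant_mul_vol o (q := 2) (by norm_num) _ hα]; norm_num [revSign]

theorem quant_eight_mul_vol {α : Forms V} (hα : α ∈ ⋀[ℝ]^8 (Module.Dual ℝ V)) :
    quant V α * vol o = quant V (hodge o α) := by
  rw [quant_mul_vol o (q := 0) (by norm_num) _ hα]; norm_num [revSign]

theorem vol_mul_quant_even {p : ℕ} (hp : Even p) {α : Forms V}
    (hα : α ∈ ⋀[ℝ]^p (Module.Dual ℝ V)) : vol o * quant V α = quant V α * vol o := by
  rw [vol_mul_quant o α hα, hp.neg_one_pow, one_smul]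

theorem hodge_hodge_two {ω : Forms V} (hω : ω ∈ ⋀[ℝ]^2 (Module.Dual ℝ V)) :
    hodge o (hodge o ω) = ω := by
  apply (quant V).injective
  rw [← neg_eq_iff_eq_neg.2 (quant_six_mul_vol o (hodge_mem o (q := 6) (by norm_num) hω)),
    ← neg_mul, ← quant_two_mul_vol o hω, mul_assoc, vol_mul_vol, mul_one]

theorem contractedWedge_two_mem {Θ Φ : Forms V} (hΘ : Θ ∈ ⋀[ℝ]^4 (Module.Dual ℝ V))
    (hΦ : Φ ∈ ⋀[ℝ]^4 (Module.Dual ℝ V)) : contractedWedge 2 Θ Φ ∈ ⋀[ℝ]^4 (Module.Dual ℝ V) :=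
  contractedWedge_mem (p := 2) (q := 2) hΘ hΦ

variable {o} {μ : ℝ} {ω : ⋀[ℝ]^2 (Module.Dual ℝ V)} {Θ : ⋀[ℝ]^4 (Module.Dual ℝ V)}

theorem quant_mul_vol_of_selfDual (hsd : hodge o (Θ : Forms V) = μ • (Θ : Forms V)) :
    quant V (Θ : Forms V) * vol o = μ • quant V (Θ : Forms V) := by
  rw [quant_four_mul_vol o Θ.2, hsd, map_smul]

theorem vol_mul_quant_of_selfDual (hsd : hodge o (Θ : Forms V) = μ • (Θ : Forms V)) :
    vol o * quant V (Θ : Forms V) = μ • quant V (Θ : Forms V) := by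
  rw [vol_mul_quant_even o (by decide) Θ.2, quant_mul_vol_of_selfDual hsd]

/-- A self-dual four-form satisfies `Θ ∧ Θ = μ ⟨Θ, Θ⟩ ν`. -/
theorem mul_self_of_selfDual (hμ : μ = 1 ∨ μ = -1)
    (hsd : hodge o (Θ : Forms V) = μ • (Θ : Forms V)) :
    (Θ : Forms V) * Θ = (μ * formInner 4 Θ Θ) • volForm o := by
  -- In degree 8 the left side gives `⟨Θ,Θ⟩ν`, from the scalar part of the square, and the right
  -- side gives `μ Θ ∧ Θ`.
  have h1 : quant V Θ * quant V Θ * vol o = μ • (quant V Θ * quant V Θ) := by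
    rw [mul_assoc, quant_mul_vol_of_selfDual hsd, mul_smul_comm]
  have m8 : (Θ : Forms V) * Θ ∈ ⋀[ℝ]^8 (Module.Dual ℝ V) := mul_mem_exteriorPower Θ.2 Θ.2
  have m4 : genProduct 2 (Θ : Forms V) Θ ∈ ⋀[ℝ]^4 (Module.Dual ℝ V) :=
    Submodule.smul_mem _ _ (contractedWedge_two_mem Θ.2 Θ.2)
  have m4' := hodge_mem o (q := 4) (by norm_num) m4
  have m0 := hodge_mem o (q := 0) (by norm_num) m8
  have m1 := one_mem_exteriorPower (V := V)
  rw [quant_mul_self_four, add_mul, sub_mul, quant_eight_mul_vol o m8, quant_four_mul_vol o m4,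
    smul_mul_assoc, one_mul, vol, ← quant_one, ← map_smul, ← map_smul, ← map_sub, ← map_sub,
    ← map_add, ← map_add, ← map_smul] at h1
  have h2 := congrArg (degPart 8) ((quant V).injective h1)
  simp only [map_add, map_sub, map_smul, degPart_of_mem m8, degPart_of_mem (volForm_mem o),
    degPart_of_mem_ne m4 (q := 8) (by norm_num), degPart_of_mem_ne m4' (q := 8) (by norm_num),
    degPart_of_mem_ne m0 (q := 8) (by norm_num), degPart_of_mem_ne m1 (q := 8) (by norm_num)] at h2
  rw [mul_smul, ← zero_add (formInner 4 Θ Θ • volForm o), ← sub_zero (0 : Forms V), h2]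
  rcases hμ with rfl | rfl <;> simp

/-- For `ω` a two-form and `Θ` self-dual, the contraction of `ω` and `Θ` is determined by the
wedge product. -/
theorem contractedWedge_two_of_selfDual (hμ : μ = 1 ∨ μ = -1)
    (hsd : hodge o (Θ : Forms V) = μ • (Θ : Forms V)) :
    contractedWedge 2 (ω : Forms V) Θ = (2 * μ) • hodge o ((ω : Forms V) * Θ) := by
  -- The anticommutator is a `μ`-eigenvector of right multiplication by `ν`, which pairs its parts
  -- of degrees 2 and 6; degree 2 gives the claim.
  have h1 : (quant V ω * quant V Θ + quant V Θ * quant V ω) * vol o =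
      μ • (quant V ω * quant V Θ + quant V Θ * quant V ω) := by
    rw [add_mul, mul_assoc, quant_mul_vol_of_selfDual hsd, mul_assoc,
      ← vol_mul_quant_even o (by decide) ω.2, ← mul_assoc, quant_mul_vol_of_selfDual hsd]
    simp only [mul_smul_comm, smul_mul_assoc, smul_add]
  have m6 : (ω : Forms V) * Θ ∈ ⋀[ℝ]^6 (Module.Dual ℝ V) := mul_mem_exteriorPower ω.2 Θ.2
  have m2 : contractedWedge 2 (ω : Forms V) Θ ∈ ⋀[ℝ]^2 (Module.Dual ℝ V) :=
    contractedWedge_mem (p := 0) (q := 2) ω.2 Θ.2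
  have m6' := hodge_mem o (q := 2) (by norm_num) m6
  have m2' := hodge_mem o (q := 6) (by norm_num) m2
  rw [quant_anticommutator, sub_mul, smul_mul_assoc, quant_six_mul_vol o m6,
    quant_two_mul_vol o m2, ← map_neg, ← map_neg, ← map_smul, ← map_smul, ← map_sub, ← map_sub,
    ← map_smul] at h1
  have h2 := congrArg (degPart 2) ((quant V).injective h1)
  simp only [map_sub, map_smul, map_neg, degPart_of_mem m2, degPart_of_mem m6',
    degPart_of_mem_ne m6 (q := 2) (by norm_num),
    degPart_of_mem_ne m2' (q := 2) (by norm_num)] at h2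
  rcases hμ with rfl | rfl
  · have : contractedWedge 2 (ω : Forms V) Θ =
      -((1 : ℝ) • ((2 : ℝ) • (0 : Forms V) - contractedWedge 2 (ω : Forms V) Θ)) := by module
    rw [this, ← h2]; module
  · have : contractedWedge 2 (ω : Forms V) Θ =
      ((-1 : ℝ) • ((2 : ℝ) • (0 : Forms V) - contractedWedge 2 (ω : Forms V) Θ)) := by module
    rw [this, ← h2]; module

/-- The real part of the square of a chiral spinor. -/
def evenPart (o : Orientation ℝ V (Fin 8)) (μ r : ℝ) (Θ : ⋀[ℝ]^4 (Module.Dual ℝ V)) : Forms V :=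
  r • 1 + (Θ : Forms V) + (μ * r) • volForm o

/-- The imaginary part of the square of a chiral spinor. -/
def skewPart (o : Orientation ℝ V (Fin 8)) (μ : ℝ) (ω : ⋀[ℝ]^2 (Module.Dual ℝ V)) : Forms V :=
  (ω : Forms V) - μ • hodge o (ω : Forms V)

theorem quant_evenPart (r : ℝ) :
    quant V (evenPart o μ r Θ) = r • 1 + quant V (Θ : Forms V) + (μ * r) • vol o := by
  simp [evenPart, vol]

theorem quant_skewPart :
    quant V (skewPart o μ ω) = quant V (ω : Forms V) + μ • (quant V (ω : Forms V) * vol o) := by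
  rw [quant_two_mul_vol o ω.2, skewPart, map_sub, map_smul]
  module

/-- Since `ν² = 1`, the square of the real part contributes `2r²` in degree 0 and `4rΘ` in degree 4,
whence `14 = 16 - 2` and `12 = 16 - 4`. The imaginary part is `ω(1 + μν)`, with square `2ω²(1 +
μν)`. -/
theorem evenPart_mul_self_sub (hμ : μ = 1 ∨ μ = -1)
    (hsd : hodge o (Θ : Forms V) = μ • (Θ : Forms V)) (r : ℝ) :
    quant V (evenPart o μ r Θ) * quant V (evenPart o μ r Θ) -
      quant V (skewPart o μ ω) * quant V (skewPart o μ ω) -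
      (16 * r) • quant V (evenPart o μ r Θ) =
    quant V ((2 * formInner 2 ω ω + formInner 4 Θ Θ - 14 * r ^ 2) • (1 + μ • volForm o) -
      ((2 : ℝ) • ((ω : Forms V) * (ω : Forms V))
      + (2 * μ) • hodge o ((ω : Forms V) * (ω : Forms V))
      + genProduct 2 (Θ : Forms V) (Θ : Forms V) + (12 * r) • (Θ : Forms V))) := by
  have hT := quant_mul_vol_of_selfDual hsd
  have hT' := vol_mul_quant_of_selfDual hsd
  have hTT : quant V Θ * quant V Θ = formInner 4 Θ Θ • 1 + (μ * formInner 4 Θ Θ) • vol o -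
      quant V (genProduct 2 (Θ : Forms V) Θ) := by
    rw [quant_mul_self_four, mul_self_of_selfDual hμ hsd, map_smul, vol]; abel
  have hW := vol_mul_quant_even o (by decide) ω.2
  have hWW := quant_mul_self_two ω
  have hWWn : quant V ((ω : Forms V) * ω) * vol o = quant V (hodge o ((ω : Forms V) * ω)) :=
    quant_four_mul_vol o (mul_mem_exteriorPower ω.2 ω.2)
  have hB : quant V (skewPart o μ ω) * quant V (skewPart o μ ω) =
      (2 : ℝ) • (quant V ((ω : Forms V) * ω) + μ • quant V (hodge o ((ω : Forms V) * ω))) -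
        (2 * formInner 2 ω ω) • (1 + μ • vol o) := by
    have e1 : quant V ω * (quant V ω * vol o) = quant V ω * quant V ω * vol o :=
      (mul_assoc _ _ _).symm
    have e2 : quant V ω * vol o * quant V ω = quant V ω * quant V ω * vol o := by
      rw [mul_assoc, hW, mul_assoc]
    have e3 : quant V ω * vol o * (quant V ω * vol o) = quant V ω * quant V ω := by
      rw [← mul_assoc, e2, mul_assoc, vol_mul_vol, mul_one]
    rw [quant_skewPart]
    simp only [mul_add, add_mul, smul_mul_assoc, mul_smul_comm, e1, e2, e3, hWW, sub_mul, hWWn,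
      one_mul]
    rcases hμ with rfl | rfl <;> module
  rw [hB, quant_evenPart]
  simp only [mul_add, add_mul, smul_mul_assoc, mul_smul_comm, one_mul, mul_one, vol_mul_vol, hT,
    hT', hTT, map_add, map_sub, map_smul, quant_one, quant_volForm]
  rcases hμ with rfl | rfl <;> module

/-- The terms `r(1 + μν)` contribute `4r` times the imaginary part, leaving `-12r`; the
anticommutator with `Θ` carries a factor 4, hence the 3. The degree 2 component is the Hodge dual of
the degree 6 one. -/
theorem evenPart_anticommutator_sub (hμ : μ = 1 ∨ μ = -1)
    (hsd : hodge o (Θ : Forms V) = μ • (Θ : Forms V)) (r : ℝ) :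
    quant V (evenPart o μ r Θ) * quant V (skewPart o μ ω) +
      quant V (skewPart o μ ω) * quant V (evenPart o μ r Θ) -
      (16 * r) • quant V (skewPart o μ ω) =
    quant V ((4 : ℝ) • ((ω : Forms V) * Θ + (3 * μ * r) • hodge o (ω : Forms V)) -
      (4 * μ) • hodge o ((ω : Forms V) * Θ + (3 * μ * r) • hodge o (ω : Forms V))) := by
  have hT := quant_mul_vol_of_selfDual hsd
  have hT' := vol_mul_quant_of_selfDual hsd
  have hW := vol_mul_quant_even o (by decide) ω.2
  have hc := quant_anticommutator ω Θ
  rw [contractedWedge_two_of_selfDual hμ hsd, map_smul] at hc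
  have e1 : vol o * (quant V ω * vol o) = quant V ω := by
    rw [← mul_assoc, hW, mul_assoc, vol_mul_vol, mul_one]
  have e2 : quant V ω * vol o * vol o = quant V ω := by
    rw [mul_assoc, vol_mul_vol, mul_one]
  have e3 : quant V Θ * (quant V ω * vol o) = μ • (quant V Θ * quant V ω) := by
    rw [← hW, ← mul_assoc, hT, smul_mul_assoc]
  have e4 : quant V ω * vol o * quant V Θ = μ • (quant V ω * quant V Θ) := by
    rw [mul_assoc, hT', mul_smul_comm]
  have hc' : quant V ω * quant V Θ = (2 : ℝ) • quant V ((ω : Forms V) * Θ) -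
      (2 * μ) • quant V (hodge o ((ω : Forms V) * Θ)) - quant V Θ * quant V ω := by
    rw [← hc]; abel
  have hn : quant V ω * vol o = -quant V (hodge o ω) := quant_two_mul_vol o ω.2
  rw [quant_evenPart, quant_skewPart, hodge_add, hodge_smul, hodge_hodge_two o ω.2]
  simp only [mul_add, add_mul, smul_mul_assoc, mul_smul_comm, one_mul, mul_one, e1, e2, e3, e4,
    hW, hc', map_add, map_sub, map_smul]
  simp only [hn]
  rcases hμ with rfl | rfl <;> module

/-- The quadratic system is equivalent to the Clifford algebra equation `α ⋄ α = 16 r α`, split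
into its real and imaginary parts. -/
theorem clifford_square_iff (hμ : μ = 1 ∨ μ = -1)
    (hsd : hodge o (Θ : Forms V) = μ • (Θ : Forms V)) (r : ℝ) :
    (quant V (evenPart o μ r Θ) * quant V (evenPart o μ r Θ) -
      quant V (skewPart o μ ω) * quant V (skewPart o μ ω) =
        (16 * r) • quant V (evenPart o μ r Θ) ∧
    quant V (evenPart o μ r Θ) * quant V (skewPart o μ ω) +
      quant V (skewPart o μ ω) * quant V (evenPart o μ r Θ) =
        (16 * r) • quant V (skewPart o μ ω)) ↔
    14 * r ^ 2 = 2 * formInner 2 ω ω + formInner 4 Θ Θ ∧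
      (2 : ℝ) • ((ω : Forms V) * (ω : Forms V))
      + (2 * μ) • hodge o ((ω : Forms V) * (ω : Forms V))
      + genProduct 2 (Θ : Forms V) (Θ : Forms V) + (12 * r) • (Θ : Forms V) = 0 ∧
      (ω : Forms V) * Θ + (3 * μ * r) • hodge o (ω : Forms V) = 0 := by
  rw [← sub_eq_zero, evenPart_mul_self_sub hμ hsd, ← sub_eq_zero (b := (16 * r) • _),
    evenPart_anticommutator_sub hμ hsd, LinearEquiv.map_eq_zero_iff, LinearEquiv.map_eq_zero_iff]
  have m4 : (2 : ℝ) • ((ω : Forms V) * (ω : Forms V))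
      + (2 * μ) • hodge o ((ω : Forms V) * (ω : Forms V))
      + genProduct 2 (Θ : Forms V) (Θ : Forms V) + (12 * r) • (Θ : Forms V) ∈
      ⋀[ℝ]^4 (Module.Dual ℝ V) := by
    have mω : (ω : Forms V) * ω ∈ ⋀[ℝ]^4 (Module.Dual ℝ V) := mul_mem_exteriorPower ω.2 ω.2
    exact add_mem (add_mem (add_mem (Submodule.smul_mem _ _ mω)
      (Submodule.smul_mem _ _ (hodge_mem o (by norm_num) mω)))
      (Submodule.smul_mem _ _ (contractedWedge_two_mem Θ.2 Θ.2))) (Submodule.smul_mem _ _ Θ.2)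
  have m6 : (ω : Forms V) * Θ + (3 * μ * r) • hodge o (ω : Forms V) ∈ ⋀[ℝ]^6 (Module.Dual ℝ V) :=
    add_mem (mul_mem_exteriorPower ω.2 Θ.2)
      (Submodule.smul_mem _ _ (hodge_mem o (by norm_num) ω.2))
  have m2 := hodge_mem o (q := 2) (by norm_num) m6
  have m1 := one_mem_exteriorPower (V := V)
  constructor
  · rintro ⟨h1, h2⟩
    have hd (p : ℕ) : degPart p (1 + μ • volForm o) =
        degPart p 1 + μ • degPart p (volForm o) := by rw [map_add, map_smul]
    have a0 := congrArg (degPart 0) h1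
    have a4 := congrArg (degPart 4) h1
    have a6 := congrArg (degPart 6) h2
    simp only [map_sub, map_smul, hd, degPart_of_mem m1, map_zero,
      degPart_of_mem_ne (volForm_mem o) (q := 0) (by norm_num),
      degPart_of_mem_ne m4 (q := 0) (by norm_num), smul_zero, add_zero, sub_zero] at a0
    simp only [map_sub, map_smul, hd, degPart_of_mem_ne m1 (q := 4) (by norm_num),
      degPart_of_mem_ne (volForm_mem o) (q := 4) (by norm_num), map_zero,
      degPart_of_mem m4, smul_zero, add_zero, zero_sub, neg_eq_zero] at a4
    simp only [map_sub, map_smul, degPart_of_mem m6,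
      degPart_of_mem_ne m2 (q := 6) (by norm_num), map_zero, smul_zero, sub_zero] at a6
    refine ⟨?_, a4, (smul_eq_zero.1 a6).resolve_left (by norm_num)⟩
    have := (smul_eq_zero.1 a0).resolve_right one_ne_zero
    linarith
  · rintro ⟨h1, h2, h3⟩
    rw [h2, h3, h1]
    simp [hodge]

end QuadraticSystem

/-! ### Real and imaginary parts in a complexification. -/

section Complexification

variable {M : Type*} [AddCommGroup M] [Module ℝ M]

/-- The complex combination `x + i y` in a complexification. -/
def cplx (x y : M) : ℂ ⊗[ℝ] M := 1 ⊗ₜ[ℝ] x + Complex.I ⊗ₜ[ℝ] y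

theorem tmul_eq_cplx (c : ℂ) (x : M) : c ⊗ₜ[ℝ] x = cplx (c.re • x) (c.im • x) := by
  rw [cplx, ← TensorProduct.smul_tmul, ← TensorProduct.smul_tmul, ← TensorProduct.add_tmul]
  congr 1
  simpa [mul_comm] using (Complex.re_add_im c).symm

theorem cplx_add (x y x' y' : M) : cplx x y + cplx x' y' = cplx (x + x') (y + y') := by
  simp only [cplx, TensorProduct.tmul_add]; abel

theorem exists_eq_cplx (z : ℂ ⊗[ℝ] M) : ∃ x y : M, z = cplx x y := by
  induction z using TensorProduct.induction_on with
  | zero => exact ⟨0, 0, by simp [cplx]⟩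
  | tmul c x => exact ⟨_, _, tmul_eq_cplx c x⟩
  | add z w hz hw =>
    obtain ⟨x, y, rfl⟩ := hz
    obtain ⟨x', y', rfl⟩ := hw
    exact ⟨_, _, cplx_add _ _ _ _⟩

theorem cplx_eq_zero_iff {x y : M} : cplx x y = 0 ↔ x = 0 ∧ y = 0 := by
  constructor
  · intro h
    have h1 := congrArg (fun z => TensorProduct.lid ℝ M (LinearMap.rTensor M Complex.reLm z)) h
    have h2 := congrArg (fun z => TensorProduct.lid ℝ M (LinearMap.rTensor M Complex.imLm z)) h
    simp only [cplx, map_add, LinearMap.rTensor_tmul, TensorProduct.lid_tmul, map_zero] at h1 h2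
    simpa using And.intro h1 h2
  · rintro ⟨rfl, rfl⟩; simp [cplx]

end Complexification

/-! ### The number operator and positivity of the metric on forms. -/

section NumberOperator

variable {V : Type*} [NormedAddCommGroup V] [InnerProductSpace ℝ V] [FiniteDimensional ℝ V]

/-- The operator multiplying `p`-forms by `p`. -/
def numberOp : Forms V →ₗ[ℝ] Forms V :=
  ∑ i, LinearMap.mulLeft ℝ (oneForm (stdOrthonormalBasis ℝ V i)) ∘ₗ
    interiorProd (stdOrthonormalBasis ℝ V i)

theorem numberOp_apply (x : Forms V) : numberOp x =
    ∑ i, oneForm (stdOrthonormalBasis ℝ V i) * interiorProd (stdOrthonormalBasis ℝ V i) x := by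
  simp [numberOp]

theorem sum_inner_smul_oneForm (v : V) :
    ∑ i, ⟪v, stdOrthonormalBasis ℝ V i⟫_ℝ • oneForm (stdOrthonormalBasis ℝ V i) = oneForm v := by
  conv_rhs => rw [← (stdOrthonormalBasis ℝ V).sum_repr' v]
  simp only [oneForm, map_sum, map_smul, real_inner_comm]

theorem numberOp_of_mem (p : ℕ) :
    ∀ x ∈ ⋀[ℝ]^p (Module.Dual ℝ V), numberOp x = (p : ℝ) • x := by
  induction p with
  | zero => intro x hx; simp [numberOp_apply, interiorProd_eq_zero _ hx]
  | succ p ih =>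
    refine exteriorPower_succ_induction (fun x y hx hy => ?_) fun v x hx => ?_
    · simp only [map_add, hx, hy, smul_add]
    · have h (w : V) : oneForm w * oneForm v = -(oneForm v * oneForm w) :=
        eq_neg_of_add_eq_zero_left (ExteriorAlgebra.ι_add_mul_swap _ _)
      have h1 := ih x hx
      rw [numberOp_apply] at h1 ⊢
      have e (i) : oneForm (stdOrthonormalBasis ℝ V i) *
          interiorProd (stdOrthonormalBasis ℝ V i) (oneForm v * x) =
          (⟪v, stdOrthonormalBasis ℝ V i⟫_ℝ • oneForm (stdOrthonormalBasis ℝ V i)) * x +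
            oneForm v * (oneForm (stdOrthonormalBasis ℝ V i) *
              interiorProd (stdOrthonormalBasis ℝ V i) x) := by
        rw [interiorProd_oneForm_mul, mul_sub, mul_smul_comm, smul_mul_assoc, ← mul_assoc, h,
          neg_mul, mul_assoc, sub_neg_eq_add]
      rw [Finset.sum_congr rfl fun i _ => e i, Finset.sum_add_distrib, ← Finset.sum_mul,
        sum_inner_smul_oneForm, ← Finset.mul_sum, h1, mul_smul_comm, Nat.cast_succ, add_smul,
        one_smul, add_comm]

/-- The number operator annihilates `x`, yet multiplies its degree `p` component by `p ≠ 0`. -/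
theorem degPart_eq_zero_of_interiorProd {x : Forms V} (h : ∀ v, interiorProd v x = 0) {p : ℕ}
    (hp : p ≠ 0) : degPart p x = 0 := by
  have h0 : numberOp x = 0 := by simp [numberOp_apply, h]
  have h1 := degPart_apply_of_smul numberOp (fun p => (p : ℝ)) numberOp_of_mem p x
  rw [h0, map_zero] at h1
  exact (smul_eq_zero.1 h1.symm).resolve_left (by exact_mod_cast hp)

theorem degPart_interiorProd (p : ℕ) (v : V) (x : Forms V) :
    degPart p (interiorProd v x) = interiorProd v (degPart (p + 1) x) := by
  refine forms_induction (P := fun x => degPart p (interiorProd v x) =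
    interiorProd v (degPart (p + 1) x)) (fun x y hx hy => by simp only [map_add, hx, hy])
    (fun q x hx => ?_) x
  cases q with
  | zero => simp [interiorProd_eq_zero v hx, degPart_of_mem_ne hx (q := p + 1) (by omega)]
  | succ q =>
    rcases eq_or_ne q p with rfl | h
    · rw [degPart_of_mem hx, degPart_of_mem (interiorProd_mem v x hx)]
    · rw [degPart_of_mem_ne hx (by omega), degPart_of_mem_ne (interiorProd_mem v x hx) h, map_zero]

/-- Unfolding the contractions gives a sum of squares of coefficients; if it vanishes, so do all
`ι_{e_i} α`, and hence `α`. This yields positive definiteness of `formInner`. -/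
theorem contractedWedge_self_nonneg (k : ℕ) : ∀ α ∈ ⋀[ℝ]^k (Module.Dual ℝ V),
    ∃ c : ℝ, contractedWedge k α α = algebraMap ℝ (Forms V) c ∧ 0 ≤ c ∧ (c = 0 → α = 0) := by
  induction k with
  | zero =>
    intro α hα
    obtain ⟨r, rfl⟩ := mem_exteriorPower_zero.1 hα
    exact ⟨r * r, by simp [contractedWedge], mul_self_nonneg r, fun h => by
      rw [mul_self_eq_zero.1 h, map_zero]⟩
  | succ k ih =>
    intro α hα
    choose c h1 h2 h3 using fun i =>
      ih _ (interiorProd_mem (stdOrthonormalBasis ℝ V i) α hα)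
    refine ⟨∑ i, c i, by simp [contractedWedge, h1], Finset.sum_nonneg fun i _ => h2 i, fun h => ?_⟩
    have h4 (i) : interiorProd (stdOrthonormalBasis ℝ V i) α = 0 :=
      h3 i ((Finset.sum_eq_zero_iff_of_nonneg fun i _ => h2 i).1 h i (Finset.mem_univ i))
    have h5 (v : V) : interiorProd v α = 0 := by
      rw [← (stdOrthonormalBasis ℝ V).sum_repr' v, interiorProd_sum_left]
      simp [interiorProd_smul_left, h4]
    rw [← degPart_of_mem hα, degPart_eq_zero_of_interiorProd h5 (by omega)]

theorem algebraMap_forms_injective : Function.Injective (algebraMap ℝ (Forms V)) :=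
  (ExteriorAlgebra.algebraMap_leftInverse _).injective

theorem formInner_self_nonneg_and (k : ℕ) (α : ⋀[ℝ]^k (Module.Dual ℝ V)) :
    0 ≤ formInner k α α ∧ (formInner k α α = 0 → α = 0) := by
  obtain ⟨c, h1, h2, h3⟩ := contractedWedge_self_nonneg k (α : Forms V) α.2
  rw [contractedWedge_full, ← Algebra.algebraMap_eq_smul_one] at h1
  have h4 := algebraMap_forms_injective h1
  have hk : (0 : ℝ) < k.factorial := by positivity
  refine ⟨nonneg_of_mul_nonneg_right (h4 ▸ h2) hk, fun h => Subtype.ext (h3 ?_)⟩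
  rw [← h4, h, mul_zero]

theorem formInner_self_nonneg (k : ℕ) (α : ⋀[ℝ]^k (Module.Dual ℝ V)) : 0 ≤ formInner k α α :=
  (formInner_self_nonneg_and k α).1

theorem formInner_self_pos {k : ℕ} {α : ⋀[ℝ]^k (Module.Dual ℝ V)} (h : α ≠ 0) :
    0 < formInner k α α :=
  (formInner_self_nonneg k α).lt_of_ne fun h' => h ((formInner_self_nonneg_and k α).2 h'.symm)

end NumberOperator

/-! ### Irreducible representations are surjective. -/

section Burnside

variable {A S : Type*} [Ring A] [Algebra ℂ A] [Module.Finite ℂ A] [AddCommGroup S] [Module ℂ S]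

/-- Burnside's theorem: an irreducible representation of a finite-dimensional complex algebra is
finite-dimensional and surjects onto all endomorphisms. -/
theorem finite_and_surjective_of_irreducible (γ : A →ₐ[ℂ] Module.End ℂ S) [Nontrivial S]
    (h : ∀ W : Submodule ℂ S, (∀ z, ∀ x ∈ W, γ z x ∈ W) → W = ⊥ ∨ W = ⊤) :
    Module.Finite ℂ S ∧ Function.Surjective γ := by
  let _ : Module A S := Module.compHom S γ.toRingHom
  have hsmul (z : A) (x : S) : z • x = γ z x := rfl
  have : IsScalarTower ℂ A S := ⟨fun c z x => by
    rw [hsmul, hsmul, map_smul, LinearMap.smul_apply]⟩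
  have : IsSimpleModule A S := by
    rw [isSimpleModule_iff]
    exact { eq_bot_or_eq_top := fun W => by
              rcases h (W.restrictScalars ℂ) fun z x hx => W.smul_mem z hx with h' | h'
              · left; exact (Submodule.restrictScalars_eq_bot_iff ℂ A S).1 h'
              · right; exact (Submodule.restrictScalars_eq_top_iff ℂ A S).1 h' }
  have hfin : Module.Finite ℂ S := by
    obtain ⟨x, hx⟩ := exists_ne (0 : S)
    exact Module.Finite.of_surjective ((LinearMap.toSpanSingleton A S x).restrictScalars ℂ)
      (IsSimpleModule.toSpanSingleton_surjective A hx)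
  refine ⟨hfin, fun T => ?_⟩
  have hschur := (IsSimpleModule.algebraMap_end_bijective_of_isAlgClosed (A := A) (V := S) ℂ).2
  -- By Schur's lemma the commutant consists of scalars, so every complex-linear `T` commutes with
  -- it; density on a finite spanning set then realizes `T` by an algebra element.
  let f : Module.End (Module.End A S) S :=
    { toFun := T
      map_add' := map_add T
      map_smul' := fun d x => by
        obtain ⟨c, rfl⟩ := hschur d
        exact map_smul T c x }
  obtain ⟨s, hs⟩ := hfin.fg_top
  obtain ⟨r, hr⟩ := jacobson_density f s
  refine ⟨r, LinearMap.ext_on hs fun x hx => ?_⟩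
  exact (hr x hx).symm

end Burnside

/-! ### Faithfulness, dimension and traces of the spinor module. -/

section Representation

variable {V : Type*} [NormedAddCommGroup V] [InnerProductSpace ℝ V] [FiniteDimensional ℝ V]
  [hV : Fact (Module.finrank ℝ V = 8)] (o : Orientation ℝ V (Fin 8))
  {S : Type*} [AddCommGroup S] [Module ℂ S] (γ : ComplexClifford V →ₐ[ℂ] Module.End ℂ S)

/-- The action of a real Clifford algebra element. -/
def rep (x : CliffordAlgebra (dualQuadraticForm V)) : Module.End ℂ S := γ (1 ⊗ₜ[ℝ] x)

theorem rep_add (x y : CliffordAlgebra (dualQuadraticForm V)) :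
    rep γ (x + y) = rep γ x + rep γ y := by
  rw [rep, TensorProduct.tmul_add, map_add]; rfl

theorem rep_sub (x y : CliffordAlgebra (dualQuadraticForm V)) :
    rep γ (x - y) = rep γ x - rep γ y := by
  rw [rep, TensorProduct.tmul_sub, map_sub]; rfl

theorem rep_mul (x y : CliffordAlgebra (dualQuadraticForm V)) :
    rep γ (x * y) = rep γ x * rep γ y := by
  rw [rep, rep, rep, ← map_mul, Algebra.TensorProduct.tmul_mul_tmul, one_mul]

theorem rep_one : rep γ 1 = 1 := map_one γ

theorem rep_smul (c : ℝ) (x : CliffordAlgebra (dualQuadraticForm V)) :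
    rep γ (c • x) = (c : ℂ) • rep γ x := by
  rw [rep, rep, ← map_smul, ← TensorProduct.smul_tmul, TensorProduct.smul_tmul']
  congr 2

theorem apply_cplx (x y : CliffordAlgebra (dualQuadraticForm V)) :
    γ (cplx x y) = rep γ x + Complex.I • rep γ y := by
  rw [cplx, map_add, rep, rep, ← map_smul, TensorProduct.smul_tmul', smul_eq_mul, mul_one]

theorem chevalleyRiesz_cplx (a b : Forms V) :
    chevalleyRiesz V (cplx a b) = cplx (quant V a) (quant V b) := by
  rw [cplx, map_add]; rfl

theorem quantize_cplx (a b : Forms V) :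
    quantize γ (cplx a b) = rep γ (quant V a) + Complex.I • rep γ (quant V b) := by
  rw [← apply_cplx, ← chevalleyRiesz_cplx]; rfl

/-- Conjugation by `ν` supplies the parity sign, so contraction becomes a combination of left and
right Clifford multiplications valid for inhomogeneous `x`. The kernel of a representation is thus
stable under contraction. -/
theorem two_smul_quant_interiorProd (v : V) (x : Forms V) :
    (2 : ℝ) • quant V (interiorProd v x) =
      gen v * quant V x - vol o * quant V x * vol o * gen v := by
  refine forms_induction (P := fun x => (2 : ℝ) • quant V (interiorProd v x) =
    gen v * quant V x - vol o * quant V x * vol o * gen v) (fun x y hx hy => ?_)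
    (fun p x hx => ?_) x
  · simp only [map_add, smul_add, hx, hy, mul_add, add_mul]; abel
  · rw [vol_mul_quant o x hx, smul_mul_assoc, mul_assoc (quant V x), vol_mul_vol, mul_one,
      smul_mul_assoc, quant_mul_gen v hx, gen_mul_quant, smul_smul, ← mul_pow, map_sub]
    simp only [neg_mul_neg, one_mul, one_pow]
    module

-- A form in the kernel has all its contractions in the kernel; these have lower degree, so they
-- vanish inductively and the form is a scalar, which acts as zero on a nonzero module only if it is
-- zero.
include o in
theorem eq_zero_of_rep_quant [Nontrivial S] (a b : Forms V)
    (h : rep γ (quant V a) + Complex.I • rep γ (quant V b) = 0) : a = 0 ∧ b = 0 := by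
  -- Here `k` strictly bounds the degrees that occur; `k = 9` is no restriction in dimension eight.
  suffices H : ∀ k, ∀ a b : Forms V, (∀ p, k ≤ p → degPart p a = 0 ∧ degPart p b = 0) →
      rep γ (quant V a) + Complex.I • rep γ (quant V b) = 0 → a = 0 ∧ b = 0 from
    H 9 a b (fun p hp => ⟨exteriorPower_eq_zero hp (degPart_mem p a),
      exteriorPower_eq_zero hp (degPart_mem p b)⟩) h
  intro k
  induction k with
  | zero =>
    intro a b h0 _
    rw [← sum_degPart a, ← sum_degPart b]
    simp [fun p => (h0 p (Nat.zero_le p)).1, fun p => (h0 p (Nat.zero_le p)).2]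
  | succ k ih =>
    intro a b h0 h1
    have h2 (v : V) : interiorProd v a = 0 ∧ interiorProd v b = 0 := by
      refine ih _ _ (fun p hp => ?_) ?_
      · rw [degPart_interiorProd, degPart_interiorProd, (h0 _ (by omega)).1,
          (h0 _ (by omega)).2, map_zero]
        exact ⟨rfl, rfl⟩
      · have e (x : Forms V) : (2 : ℂ) • rep γ (quant V (interiorProd v x)) =
            rep γ (gen v) * rep γ (quant V x) -
              rep γ (vol o) * rep γ (quant V x) * rep γ (vol o * gen v) := by
          rw [← rep_mul, ← rep_mul, ← rep_mul, ← rep_sub, ← mul_assoc,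
            ← two_smul_quant_interiorProd, rep_smul]
          simp
        have e2 : (2 : ℂ) • (rep γ (quant V (interiorProd v a)) +
            Complex.I • rep γ (quant V (interiorProd v b))) =
            rep γ (gen v) * (rep γ (quant V a) + Complex.I • rep γ (quant V b)) -
              rep γ (vol o) * (rep γ (quant V a) + Complex.I • rep γ (quant V b)) *
                rep γ (vol o * gen v) := by
          rw [smul_add, smul_comm (2 : ℂ), e, e]
          simp only [mul_add, add_mul, mul_smul_comm, smul_mul_assoc, smul_sub]
          abel
        rw [h1, mul_zero, mul_zero, zero_mul, sub_zero] at e2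
        exact (smul_eq_zero.1 e2).resolve_left two_ne_zero
    have h3 (x : Forms V) (hx : ∀ v, interiorProd v x = 0) : ∃ r : ℝ, x = algebraMap ℝ _ r := by
      obtain ⟨r, hr⟩ := mem_exteriorPower_zero.1 (degPart_mem 0 x)
      refine ⟨r, ?_⟩
      rw [hr]
      conv_lhs => rw [← sum_degPart x]
      exact Finset.sum_eq_single 0 (fun p _ hp => degPart_eq_zero_of_interiorProd hx hp) (by simp)
    obtain ⟨r, rfl⟩ := h3 a fun v => (h2 v).1
    obtain ⟨s, rfl⟩ := h3 b fun v => (h2 v).2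
    rw [quant_algebraMap, quant_algebraMap, Algebra.algebraMap_eq_smul_one,
      Algebra.algebraMap_eq_smul_one, rep_smul, rep_smul, rep_one, smul_smul, ← add_smul] at h1
    have h4 := (smul_eq_zero.1 h1).resolve_right one_ne_zero
    have hr := congrArg Complex.re h4
    have hs := congrArg Complex.im h4
    simp at hr hs
    simp [hr, hs]

include o in
theorem rep_injective [Nontrivial S] {x y : CliffordAlgebra (dualQuadraticForm V)}
    (h : rep γ x + Complex.I • rep γ y = 0) : x = 0 ∧ y = 0 := by
  obtain ⟨a, rfl⟩ := (quant V).surjective x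
  obtain ⟨b, rfl⟩ := (quant V).surjective y
  obtain ⟨rfl, rfl⟩ := eq_zero_of_rep_quant o γ a b h
  simp

include o in
theorem apply_injective [Nontrivial S] : Function.Injective γ := by
  rw [injective_iff_map_eq_zero]
  intro z hz
  obtain ⟨x, y, rfl⟩ := exists_eq_cplx z
  rw [apply_cplx] at hz
  exact cplx_eq_zero_iff.2 (rep_injective o γ hz)

theorem finrank_forms : Module.finrank ℝ (Forms V) = 256 ∧ Module.Finite ℝ (Forms V) := by
  have b : Module.Basis (Fin 8) ℝ (Module.Dual ℝ V) :=
    Module.finBasisOfFinrankEq ℝ _ (by rw [Subspace.dual_finrank_eq, hV.out])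
  refine ⟨?_, Module.Finite.of_basis b.ExteriorAlgebra⟩
  rw [Module.finrank_eq_card_basis b.ExteriorAlgebra]
  simp

instance : Module.Finite ℝ (CliffordAlgebra (dualQuadraticForm V)) :=
  have := (finrank_forms (V := V)).2
  Module.Finite.equiv (quant V)

-- Faithfulness and Burnside's theorem identify the algebra, of complex dimension `2^8 = 16²`, with
-- the endomorphisms of the module.
include o in
theorem finite_and_finrank (hγ : IsIrreducibleModule γ) :
    Module.Finite ℂ S ∧ Module.finrank ℂ S = 16 := by
  have := hγ.1
  obtain ⟨h1, h2⟩ := finite_and_surjective_of_irreducible γ hγ.2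
  refine ⟨h1, ?_⟩
  have h3 := (LinearEquiv.ofBijective γ.toLinearMap ⟨apply_injective o γ, h2⟩).finrank_eq
  rw [Module.finrank_baseChange, ← (quant V).finrank_eq, finrank_forms.1,
    Module.finrank_linearMap] at h3
  nlinarith

/-- For odd `p` the graded commutator is an ordinary one, so `v ∧ x` acts as half a commutator. -/
theorem trace_rep_quant [Module.Finite ℂ S] {p : ℕ} (hp : Odd p) :
    ∀ α ∈ ⋀[ℝ]^(p + 1) (Module.Dual ℝ V), LinearMap.trace ℂ S (rep γ (quant V α)) = 0 := by
  refine exteriorPower_succ_induction (fun x y hx hy => ?_) fun v x hx => ?_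
  · rw [map_add, rep_add, map_add, hx, hy, add_zero]
  · have h1 := congrArg (fun y => LinearMap.trace ℂ S (rep γ y)) (two_smul_quant_oneForm_mul v hx)
    simp only [hp.neg_one_pow, rep_smul, rep_add, rep_mul, map_smul, map_add,
      LinearMap.trace_mul_comm ℂ (rep γ (quant V x))] at h1
    simpa using h1

end Representation

/-! ### Hermitian squares of chiral spinors. -/

section HermitianSquare

variable {V : Type*} [NormedAddCommGroup V] [InnerProductSpace ℝ V] [FiniteDimensional ℝ V]
  [hV : Fact (Module.finrank ℝ V = 8)] {o : Orientation ℝ V (Fin 8)}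
  {S : Type*} [AddCommGroup S] [Module ℂ S] {γ : ComplexClifford V →ₐ[ℂ] Module.End ℂ S}
  {B : S →ₗ[ℂ] S →ₗ⋆[ℂ] ℂ}
  {μ : ℝ} {ω : ⋀[ℝ]^2 (Module.Dual ℝ V)} {Θ : ⋀[ℝ]^4 (Module.Dual ℝ V)}

theorem conjReverse_cplx (x y : CliffordAlgebra (dualQuadraticForm V)) :
    conjReverse V (cplx x y) =
      cplx (CliffordAlgebra.reverse x) (-CliffordAlgebra.reverse y) := by
  simp [conjReverse, cplx, TensorProduct.neg_tmul, TensorProduct.tmul_neg]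

theorem reverse_vol : CliffordAlgebra.reverse (vol o) = vol o := by
  rw [vol, reverse_quant _ (volForm_mem o)]; norm_num [revSign]

theorem reverse_quant_evenPart (r : ℝ) :
    CliffordAlgebra.reverse (quant V (evenPart o μ r Θ)) = quant V (evenPart o μ r Θ) := by
  rw [quant_evenPart, map_add, map_add, map_smul, map_smul, CliffordAlgebra.reverse.map_one,
    reverse_vol, reverse_quant _ Θ.2]
  norm_num [revSign]

theorem reverse_quant_skewPart :
    CliffordAlgebra.reverse (quant V (skewPart o μ ω)) = -quant V (skewPart o μ ω) := by
  rw [skewPart, map_sub, map_smul, map_sub, map_smul, reverse_quant _ ω.2,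
    reverse_quant _ (hodge_mem o (q := 6) (by norm_num) ω.2)]
  norm_num [revSign]
  abel

theorem vol_mul_quant_evenPart (hμ : μ = 1 ∨ μ = -1)
    (hsd : hodge o (Θ : Forms V) = μ • (Θ : Forms V)) (r : ℝ) :
    vol o * quant V (evenPart o μ r Θ) = μ • quant V (evenPart o μ r Θ) := by
  rw [quant_evenPart, mul_add, mul_add, vol_mul_quant_of_selfDual hsd, mul_smul_comm, mul_smul_comm,
    vol_mul_vol, mul_one]
  rcases hμ with rfl | rfl <;> module

theorem vol_mul_quant_skewPart (hμ : μ = 1 ∨ μ = -1) :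
    vol o * quant V (skewPart o μ ω) = μ • quant V (skewPart o μ ω) := by
  have hW := vol_mul_quant_even o (by decide) ω.2
  rw [quant_skewPart, mul_add, mul_smul_comm, ← hW, ← mul_assoc, vol_mul_vol, one_mul]
  rcases hμ with rfl | rfl <;> module

theorem radius_nonneg (ω : ⋀[ℝ]^2 (Module.Dual ℝ V)) (Θ : ⋀[ℝ]^4 (Module.Dual ℝ V)) :
    0 ≤ radius ω Θ := Real.sqrt_nonneg _

theorem radius_sq (ω : ⋀[ℝ]^2 (Module.Dual ℝ V)) (Θ : ⋀[ℝ]^4 (Module.Dual ℝ V)) :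
    14 * radius ω Θ ^ 2 = 2 * formInner 2 ω ω + formInner 4 Θ Θ := by
  have h2 := formInner_self_nonneg 2 ω
  have h4 := formInner_self_nonneg 4 Θ
  rw [radius, Real.sq_sqrt (by positivity)]
  ring

theorem radius_eq_of_sq {r : ℝ} (hr : 0 ≤ r)
    (h : 14 * r ^ 2 = 2 * formInner 2 ω ω + formInner 4 Θ Θ) : radius ω Θ = r := by
  rw [radius, ← h, mul_div_cancel_left₀ _ (by norm_num), Real.sqrt_sq hr]

theorem radius_pos (h : Θ ≠ 0) : 0 < radius ω Θ := by
  have h2 := formInner_self_nonneg 2 ω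
  have h4 := formInner_self_pos h
  exact Real.sqrt_pos.2 (by positivity)

theorem formInner_zero (k : ℕ) : formInner k (0 : ⋀[ℝ]^k (Module.Dual ℝ V)) 0 = 0 := by
  simp [formInner]

/-- With `Θ = 0` the second equation reads `r *ω = 0`; either factor vanishing makes `r` vanish,
since `14 r² = 2⟨ω,ω⟩`. -/
theorem SolvesSystem.radius_eq_zero (hμ : μ = 1 ∨ μ = -1) (h : SolvesSystem o μ ω Θ)
    (hΘ : Θ = 0) : radius ω Θ = 0 := by
  subst hΘ
  have h2 := h.quad₂
  rw [ZeroMemClass.coe_zero, mul_zero, zero_add, smul_eq_zero] at h2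
  rcases h2 with h2 | h2
  · rcases hμ with rfl | rfl <;> linarith
  · have h3 : ω = 0 := Subtype.ext (by
      rw [← hodge_hodge_two o ω.2, h2]; simp [hodge])
    subst h3
    have := radius_sq (0 : ⋀[ℝ]^2 (Module.Dual ℝ V)) (0 : ⋀[ℝ]^4 (Module.Dual ℝ V))
    rw [formInner_zero, formInner_zero] at this
    exact pow_eq_zero_iff two_ne_zero |>.1 (by linarith)

theorem SolvesSystem.squareForm_eq (hμ : μ = 1 ∨ μ = -1) (h : SolvesSystem o μ ω Θ) :
    squareForm o μ ω Θ = cplx (evenPart o μ (radius ω Θ) Θ) (skewPart o μ ω) := by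
  have key : √((2 * formInner 2 ω ω + formInner 4 Θ Θ) / (14 * formInner 4 Θ Θ ^ 2)) •
      ((Θ : Forms V) * Θ) = (μ * radius ω Θ) • volForm o := by
    by_cases hΘ : Θ = 0
    -- At `Θ = 0` both sides vanish, whatever value the quotient under the root takes.
    · rw [h.radius_eq_zero hμ hΘ, hΘ]; simp
    · have h4 := formInner_self_pos hΘ
      rw [mul_self_of_selfDual hμ h.selfDual, ← radius_sq, mul_div_mul_left _ _ (by norm_num),
        ← div_pow, Real.sqrt_sq (div_nonneg (radius_nonneg ω Θ) h4.le), smul_smul]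
      congr 1
      field_simp
  have hc (c : ℝ) (x : Forms V) : (c : ℂ) ⊗ₜ[ℝ] x = 1 ⊗ₜ[ℝ] (c • x) := by
    rw [← TensorProduct.smul_tmul]; simp
  have hI (c : ℝ) (x : Forms V) : (Complex.I * c) ⊗ₜ[ℝ] x = Complex.I ⊗ₜ[ℝ] (c • x) := by
    rw [← TensorProduct.smul_tmul]; simp [mul_comm]
  rw [squareForm, hc, hc, hI, key, cplx, evenPart, skewPart]
  simp only [TensorProduct.tmul_add, TensorProduct.tmul_sub]
  abel

theorem IsAdmissibleInner.eq_zero_of_forall (hB : IsAdmissibleInner γ B) {x : S}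
    (h : ∀ y, B y x = 0) : x = 0 := by
  by_contra hx
  have := hB.pos_def x hx
  rw [h x] at this
  simp at this

theorem IsAdmissibleInner.self_eq (hB : IsAdmissibleInner γ B) (x : S) :
    B x x = ((B x x).re : ℂ) :=
  (Complex.conj_eq_iff_re.1 (hB.hermitian x x).symm).symm

theorem IsAdmissibleInner.self_nonneg (hB : IsAdmissibleInner γ B) (x : S) : 0 ≤ (B x x).re := by
  by_cases hx : x = 0
  · simp [hx]
  · exact (hB.pos_def x hx).le

theorem pairing_smul_left (B : S →ₗ[ℂ] S →ₗ⋆[ℂ] ℂ) (c : ℂ) (x y : S) :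
    B (c • x) y = c * B x y := by
  rw [LinearMap.map_smul, LinearMap.smul_apply, smul_eq_mul]

theorem pairing_smul_right (B : S →ₗ[ℂ] S →ₗ⋆[ℂ] ℂ) (c : ℂ) (x y : S) :
    B x (c • y) = starRingEnd ℂ c * B x y :=
  LinearMap.map_smulₛₗ _ _ _

theorem isChiral_iff {η : S} : IsChiral o γ μ η ↔ rep γ (vol o) η = (μ : ℂ) • η := Iff.rfl

/-- The Clifford algebra equation for a form with real and imaginary parts `a` and `b`. -/
theorem rep_square_iff [Nontrivial S] (o : Orientation ℝ V (Fin 8))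
    (x y : CliffordAlgebra (dualQuadraticForm V)) (c : ℝ) :
    (rep γ x + Complex.I • rep γ y) * (rep γ x + Complex.I • rep γ y) =
      (c : ℂ) • (rep γ x + Complex.I • rep γ y) ↔
    x * x - y * y = c • x ∧ x * y + y * x = c • y := by
  have e : (rep γ x + Complex.I • rep γ y) * (rep γ x + Complex.I • rep γ y) -
      (c : ℂ) • (rep γ x + Complex.I • rep γ y) =
      rep γ (x * x - y * y - c • x) + Complex.I • rep γ (x * y + y * x - c • y) := by
    simp only [rep_sub, rep_add, rep_mul, rep_smul, mul_add, add_mul, smul_mul_assoc,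
      mul_smul_comm, smul_add, smul_sub, smul_smul, Complex.I_mul_I, mul_comm (c : ℂ) Complex.I]
    module
  rw [← sub_eq_zero, e]
  constructor
  · intro h
    obtain ⟨h1, h2⟩ := rep_injective o γ h
    exact ⟨sub_eq_zero.1 h1, sub_eq_zero.1 h2⟩
  · rintro ⟨h1, h2⟩
    simp [h1, h2, rep]

theorem trace_evenPart_add_skewPart [Module.Finite ℂ S] (hS : Module.finrank ℂ S = 16) (r : ℝ) :
    LinearMap.trace ℂ S (rep γ (quant V (evenPart o μ r Θ)) +
      Complex.I • rep γ (quant V (skewPart o μ ω))) = 16 * r := by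
  rw [skewPart, quant_evenPart, map_add, map_smul, map_sub, map_smul, rep_sub, rep_add, rep_add,
    map_add, map_add, map_sub, rep_smul, rep_smul, rep_smul, map_smul, map_smul, map_smul, rep_one,
    LinearMap.trace_one, hS, trace_rep_quant γ (p := 3) (by decide) _ Θ.2,
    trace_rep_quant γ (p := 1) (by decide) _ ω.2,
    trace_rep_quant γ (p := 5) (by decide) _ (hodge_mem o (q := 6) (by norm_num) ω.2), vol,
    trace_rep_quant γ (p := 7) (by decide) _ (volForm_mem o)]
  simp [mul_comm]

/-- The components of a form that is chiral and either symmetric or antisymmetric under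
reversion. -/
theorem degPart_eq_zero_of_vol {a : Forms V} {ε : ℝ} (hμ : μ = 1 ∨ μ = -1)
    (hε : ε = 1 ∨ ε = -1)
    (hv : vol o * quant V a = μ • quant V a)
    (hr : CliffordAlgebra.reverse (quant V a) = ε • quant V a) (p : ℕ) :
    ((-1 : ℝ) ^ p = 1 ∧ revSign p = ε) ∨ degPart p a = 0 := by
  -- Reversion fixes `ν` and reverses products, turning left chirality into right chirality.
  have hv' : quant V a * vol o = μ • quant V a := by
    have := congrArg CliffordAlgebra.reverse hv
    rw [CliffordAlgebra.reverse.map_mul, reverse_vol, map_smul, hr, smul_mul_assoc,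
      smul_comm μ ε] at this
    exact smul_right_injective _ (r := ε) (by rcases hε with rfl | rfl <;> norm_num) this
  -- Conjugation by `ν` acts as `(-1)^p` in degree `p`, so fixing `a` excludes odd degrees.
  have h1 : (quant V).symm (vol o * quant V a * vol o) = a := by
    rw [hv, smul_mul_assoc, hv', LinearEquiv.symm_apply_eq]
    rcases hμ with rfl | rfl <;> module
  have h2 := degPart_apply_of_smul ((quant V).symm.toLinearMap ∘ₗ
    LinearMap.mulRight ℝ (vol o) ∘ₗ LinearMap.mulLeft ℝ (vol o) ∘ₗ (quant V).toLinearMap)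
    (fun p => (-1) ^ p) (fun p x hx => by
      simp only [LinearMap.comp_apply, LinearEquiv.coe_coe, LinearMap.mulLeft_apply,
        LinearMap.mulRight_apply]
      rw [vol_mul_quant o x hx, smul_mul_assoc, mul_assoc, vol_mul_vol, mul_one, map_smul,
        LinearEquiv.symm_apply_apply]) p a
  have h3 := degPart_apply_of_smul ((quant V).symm.toLinearMap ∘ₗ
    CliffordAlgebra.reverse ∘ₗ (quant V).toLinearMap) revSign (fun p x hx => by
      simp only [LinearMap.comp_apply, LinearEquiv.coe_coe]
      rw [reverse_quant x hx, map_smul, LinearEquiv.symm_apply_apply]) p a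
  simp only [LinearMap.comp_apply, LinearEquiv.coe_coe, LinearMap.mulLeft_apply,
    LinearMap.mulRight_apply, h1, hr, map_smul, LinearEquiv.symm_apply_apply] at h2 h3
  by_cases h0 : degPart p a = 0
  · exact Or.inr h0
  · refine Or.inl ⟨?_, (smul_left_injective ℝ h0 h3).symm⟩
    have : (1 : ℝ) • degPart p a = (-1 : ℝ) ^ p • degPart p a := by rw [one_smul]; exact h2
    exact (smul_left_injective ℝ h0 this).symm

/-- Only degrees 0, 4 and 8 are even with reversion sign `+1`. Chirality makes the middle component
self-dual up to `μ` and determines degree 8 from degree 0. -/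
theorem eq_evenPart {a : Forms V} (hμ : μ = 1 ∨ μ = -1)
    (hv : vol o * quant V a = μ • quant V a)
    (hr : CliffordAlgebra.reverse (quant V a) = quant V a) :
    ∃ (r : ℝ) (Θ : ⋀[ℝ]^4 (Module.Dual ℝ V)),
      hodge o (Θ : Forms V) = μ • (Θ : Forms V) ∧ a = evenPart o μ r Θ := by
  have h := degPart_eq_zero_of_vol hμ (Or.inl rfl) hv (by rw [hr, one_smul])
  have ha : a = degPart 0 a + degPart 4 a + degPart 8 a := by
    have h1 := (h 1).resolve_left (by norm_num)
    have h2 := (h 2).resolve_left (by norm_num [revSign])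
    have h3 := (h 3).resolve_left (by norm_num)
    have h5 := (h 5).resolve_left (by norm_num)
    have h6 := (h 6).resolve_left (by norm_num [revSign])
    have h7 := (h 7).resolve_left (by norm_num)
    conv_lhs => rw [← sum_degPart a]
    simp [Finset.sum_range_succ, h1, h2, h3, h5, h6, h7]
  obtain ⟨r, h0⟩ := mem_exteriorPower_zero.1 (degPart_mem 0 a)
  have m4 := degPart_mem 4 a
  have m8 := degPart_mem 8 a
  have m4' := hodge_mem o (q := 4) (by norm_num) m4
  have m8' := hodge_mem o (q := 0) (by norm_num) m8
  have m1 := one_mem_exteriorPower (V := V)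
  have mv := volForm_mem o
  rw [Algebra.algebraMap_eq_smul_one] at h0
  rw [← h0] at ha
  generalize degPart 4 a = Θ at ha m4 m4'
  generalize degPart 8 a = β at ha m8 m8'
  subst ha
  rw [map_add, map_add, mul_add, mul_add, vol_mul_quant_even o (by decide) m4,
    vol_mul_quant_even o (by decide) m8, quant_four_mul_vol o m4, quant_eight_mul_vol o m8, map_smul,
    quant_one, mul_smul_comm, mul_one, ← quant_volForm, ← quant_one, ← map_smul, ← map_smul,
    ← map_add, ← map_add, ← map_add, ← map_add, ← map_smul] at hv
  have hv := (quant V).injective hv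
  have e4 := congrArg (degPart 4) hv
  have e8 := congrArg (degPart 8) hv
  simp only [map_add, map_smul, degPart_of_mem m4, degPart_of_mem m4',
    degPart_of_mem_ne m1 (q := 4) (by norm_num), degPart_of_mem_ne mv (q := 4) (by norm_num),
    degPart_of_mem_ne m8 (q := 4) (by norm_num), degPart_of_mem_ne m8' (q := 4) (by norm_num),
    smul_zero, zero_add, add_zero] at e4
  simp only [map_add, map_smul, degPart_of_mem mv, degPart_of_mem m8,
    degPart_of_mem_ne m1 (q := 8) (by norm_num), degPart_of_mem_ne m4 (q := 8) (by norm_num),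
    degPart_of_mem_ne m4' (q := 8) (by norm_num), degPart_of_mem_ne m8' (q := 8) (by norm_num),
    smul_zero, zero_add, add_zero] at e8
  refine ⟨r, ⟨Θ, m4⟩, e4, ?_⟩
  rw [evenPart, mul_smul, e8]
  rcases hμ with rfl | rfl <;> simp

theorem eq_skewPart {b : Forms V} (hμ : μ = 1 ∨ μ = -1)
    (hv : vol o * quant V b = μ • quant V b)
    (hr : CliffordAlgebra.reverse (quant V b) = -quant V b) :
    ∃ ω : ⋀[ℝ]^2 (Module.Dual ℝ V), b = skewPart o μ ω := by
  have h := degPart_eq_zero_of_vol hμ (Or.inr rfl) hv (by rw [hr, neg_one_smul])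
  have hb : b = degPart 2 b + degPart 6 b := by
    have h0 := (h 0).resolve_left (by norm_num [revSign])
    have h1 := (h 1).resolve_left (by norm_num)
    have h3 := (h 3).resolve_left (by norm_num)
    have h4 := (h 4).resolve_left (by norm_num [revSign])
    have h5 := (h 5).resolve_left (by norm_num)
    have h7 := (h 7).resolve_left (by norm_num)
    have h8 := (h 8).resolve_left (by norm_num [revSign])
    conv_lhs => rw [← sum_degPart b]
    simp [Finset.sum_range_succ, h0, h1, h3, h4, h5, h7, h8]
  have m2 := degPart_mem 2 b
  have m6 := degPart_mem 6 b
  have m2' := hodge_mem o (q := 6) (by norm_num) m2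
  have m6' := hodge_mem o (q := 2) (by norm_num) m6
  generalize degPart 2 b = ω at hb m2 m2'
  generalize degPart 6 b = β at hb m6 m6'
  subst hb
  rw [map_add, mul_add, vol_mul_quant_even o (by decide) m2, vol_mul_quant_even o (by decide) m6,
    quant_two_mul_vol o m2, quant_six_mul_vol o m6, ← map_neg, ← map_neg, ← map_add, ← map_add,
    ← map_smul] at hv
  have e6 := congrArg (degPart 6) ((quant V).injective hv)
  simp only [map_add, map_neg, map_smul, degPart_of_mem m6, degPart_of_mem m2',
    degPart_of_mem_ne m2 (q := 6) (by norm_num), degPart_of_mem_ne m6' (q := 6) (by norm_num),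
    neg_zero, zero_add, add_zero] at e6
  refine ⟨⟨ω, m2⟩, ?_⟩
  rw [skewPart, ← neg_neg (hodge o _), e6]
  rcases hμ with rfl | rfl <;> simp

theorem exists_solution_of_isHermitianSquare (hγ : IsIrreducibleModule γ)
    (hB : IsAdmissibleInner γ B) (hμ : μ = 1 ∨ μ = -1) {η : S} (hη : IsChiral o γ μ η)
    {α : ComplexForms V} (hα : IsHermitianSquare γ B η α) :
    ∃ (ω : ⋀[ℝ]^2 (Module.Dual ℝ V)) (Θ : ⋀[ℝ]^4 (Module.Dual ℝ V)),
      SolvesSystem o μ ω Θ ∧ α = squareForm o μ ω Θ ∧ B η η = ((16 * radius ω Θ : ℝ) : ℂ) := by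
  have := hγ.1
  obtain ⟨_, hS⟩ := finite_and_finrank o γ hγ
  obtain ⟨a, b, rfl⟩ := exists_eq_cplx α
  rw [IsHermitianSquare] at hα
  have hE (x : S) : γ (cplx (quant V a) (quant V b)) x = B x η • η := by
    rw [apply_cplx, ← quantize_cplx, hα]; rfl
  -- The rank-one operator is self-adjoint because `B` is Hermitian; by faithfulness its Clifford
  -- element is fixed by conjugate reversion.
  have hadj : γ (cplx (quant V a) (quant V b)) =
      γ (conjReverse V (cplx (quant V a) (quant V b))) := by
    refine LinearMap.ext fun y => sub_eq_zero.1 (hB.eq_zero_of_forall fun x => ?_)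
    rw [map_sub, ← hB.adjoint, hE, hE, pairing_smul_left, pairing_smul_right,
      ← hB.hermitian, mul_comm, sub_self]
  have hrev := cplx_eq_zero_iff.1 (show cplx (quant V a - CliffordAlgebra.reverse (quant V a))
      (quant V b + CliffordAlgebra.reverse (quant V b)) = 0 by
    have h := sub_eq_zero.2 (apply_injective o γ hadj)
    rw [conjReverse_cplx] at h
    rw [← h]
    simp only [cplx, TensorProduct.tmul_add, TensorProduct.tmul_sub, TensorProduct.tmul_neg]
    abel)
  have hchi := rep_injective o γ (x := vol o * quant V a - μ • quant V a)
      (y := vol o * quant V b - μ • quant V b) (by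
    have h : rep γ (vol o) * γ (cplx (quant V a) (quant V b)) =
        (μ : ℂ) • γ (cplx (quant V a) (quant V b)) := by
      refine LinearMap.ext fun x => ?_
      rw [Module.End.mul_apply, LinearMap.smul_apply, hE, map_smul, isChiral_iff.1 hη, smul_comm]
    rw [apply_cplx, ← sub_eq_zero] at h
    rw [← h]
    simp only [rep_sub, rep_mul, rep_smul, mul_add, mul_smul_comm]
    module)
  obtain ⟨r, Θ, hsd, rfl⟩ := eq_evenPart hμ (sub_eq_zero.1 hchi.1) (sub_eq_zero.1 hrev.1).symm
  obtain ⟨ω, rfl⟩ := eq_skewPart hμ (sub_eq_zero.1 hchi.2) (eq_neg_of_add_eq_zero_right hrev.2)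
  have htr := trace_evenPart_add_skewPart (γ := γ) (o := o) (μ := μ) (ω := ω) (Θ := Θ) hS r
  rw [← quantize_cplx, hα, LinearMap.trace_smulRight] at htr
  -- The trace of `η ⊗ B(·, η)` is `B η η`, so positivity of `B` makes `r` the nonnegative root of
  -- the scalar equation.
  have hηη : B η η = 16 * (r : ℂ) := htr
  have hr : 0 ≤ r := by
    have := hB.self_nonneg η
    rw [hηη] at this
    simpa using this
  have hsq := (rep_square_iff (γ := γ) o (quant V (evenPart o μ r Θ)) (quant V (skewPart o μ ω))
    (16 * r)).1 (by
      rw [← apply_cplx]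
      refine LinearMap.ext fun x => ?_
      rw [Module.End.mul_apply, LinearMap.smul_apply, hE x, map_smul, hE η, hηη, smul_smul,
        smul_smul]
      push_cast
      rw [mul_comm])
  obtain ⟨h1, h2, h3⟩ := (clifford_square_iff hμ hsd r).1 hsq
  have hrad := radius_eq_of_sq hr h1
  rw [← hrad] at h2 h3
  have hsol : SolvesSystem o μ ω Θ := ⟨hsd, h2, h3⟩
  refine ⟨ω, Θ, hsol, ?_, ?_⟩
  · rw [hsol.squareForm_eq hμ, hrad]
  · rw [hηη, hrad]; push_cast; rfl

/-- A self-adjoint operator `E` of trace `c ≥ 0` with `E² = cE` is the square of a vector. -/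
theorem IsAdmissibleInner.exists_eq_smulRight [Module.Finite ℂ S] (hB : IsAdmissibleInner γ B)
    (E : Module.End ℂ S) (hadj : ∀ x y, B (E x) y = B x (E y)) {c : ℝ} (hc : 0 ≤ c)
    (hsq : E * E = (c : ℂ) • E) (htr : LinearMap.trace ℂ S E = c) :
    ∃ η : S, E = (B.flip η).smulRight η ∧ B η η = c ∧ ((c : ℂ) • η = E η) := by
  rcases hc.eq_or_lt with rfl | hc
  · have hE : E = 0 := by
      refine LinearMap.ext fun x => hB.eq_zero_of_forall fun y => ?_
      have h0 : E (E y) = 0 := by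
        have := LinearMap.congr_fun hsq y
        simpa using this
      by_contra hne
      have h1 : B (E y) (E y) = 0 := by rw [← hadj, h0]; simp
      have h2 : E y = 0 := by
        by_contra h
        have := hB.pos_def _ h
        simp [h1] at this
      rw [← hadj, h2] at hne
      simp at hne
    exact ⟨0, by simp [hE], by simp, by simp⟩
  · have hc' : (c : ℂ) ≠ 0 := by exact_mod_cast hc.ne'
    have hidem : IsIdempotentElem ((c : ℂ)⁻¹ • E) := by
      rw [IsIdempotentElem, smul_mul_smul_comm, hsq, smul_smul, mul_assoc, inv_mul_cancel₀ hc',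
        mul_one]
    have hrank := (LinearMap.IsIdempotentElem.isProj_range _ hidem).trace
    rw [map_smul, htr, smul_eq_mul, inv_mul_cancel₀ hc'] at hrank
    obtain ⟨⟨v, hvmem⟩, hv0, hv⟩ := finrank_eq_one_iff'.1 (show Module.finrank ℂ
      (LinearMap.range ((c : ℂ)⁻¹ • E)) = 1 by exact_mod_cast hrank.symm)
    have hv0 : v ≠ 0 := fun h => hv0 (Subtype.ext h)
    have hpos := hB.pos_def v hv0
    -- The generator of the image is rescaled to squared norm `c`, the eigenvalue of `E` there.
    set η : S := ((√(c / (B v v).re) : ℝ) : ℂ) • v with hη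
    have hηη : B η η = c := by
      rw [hη, pairing_smul_left, pairing_smul_right, hB.self_eq v, Complex.conj_ofReal, ← mul_assoc, ← Complex.ofReal_mul, ← Complex.ofReal_mul,
        Complex.ofReal_re,
        Real.mul_self_sqrt (by positivity), div_mul_cancel₀ _ hpos.ne']
    have hEv : E v = (c : ℂ) • v := by
      obtain ⟨w, rfl⟩ := hvmem
      have := LinearMap.congr_fun hsq w
      simp only [Module.End.mul_apply, LinearMap.smul_apply] at this
      rw [LinearMap.smul_apply, map_smul, this, smul_comm]
    have hEη : E η = (c : ℂ) • η := by rw [hη, map_smul, hEv, smul_comm]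
    refine ⟨η, LinearMap.ext fun x => ?_, hηη, hEη.symm⟩
    obtain ⟨t, ht⟩ := hv ⟨(c : ℂ)⁻¹ • E x, ⟨x, rfl⟩⟩
    have ht : t • v = (c : ℂ)⁻¹ • E x := congrArg Subtype.val ht
    have hs0 : ((√(c / (B v v).re) : ℝ) : ℂ) ≠ 0 := by
      have : √(c / (B v v).re) ≠ 0 := (Real.sqrt_pos.2 (by positivity)).ne'
      exact_mod_cast this
    obtain ⟨u, hu⟩ : ∃ u : ℂ, E x = u • η := by
      refine ⟨c * t * (((√(c / (B v v).re) : ℝ) : ℂ))⁻¹, ?_⟩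
      rw [hη, smul_smul, mul_assoc, inv_mul_cancel₀ hs0, mul_one, mul_smul, ht, smul_smul,
        mul_inv_cancel₀ hc', one_smul]
    -- Pairing with `η` identifies the coefficient `u` of `E x = u • η` as `B x η`.
    have h1 := hadj x η
    rw [hu, hEη, pairing_smul_left B u, hηη, pairing_smul_right B _ x, Complex.conj_ofReal,
      mul_comm] at h1
    rw [hu, mul_left_cancel₀ hc' h1]
    rfl

theorem exists_spinor_of_solvesSystem (hγ : IsIrreducibleModule γ) (hB : IsAdmissibleInner γ B)
    (hμ : μ = 1 ∨ μ = -1) (h : SolvesSystem o μ ω Θ) :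
    ∃ η : S, IsChiral o γ μ η ∧ IsHermitianSquare γ B η (squareForm o μ ω Θ) ∧
      B η η = ((16 * radius ω Θ : ℝ) : ℂ) := by
  have := hγ.1
  obtain ⟨_, hS⟩ := finite_and_finrank o γ hγ
  have hsq := (rep_square_iff (γ := γ) o _ _ _).2
    ((clifford_square_iff hμ h.selfDual (radius ω Θ)).2 ⟨radius_sq ω Θ, h.quad₁, h.quad₂⟩)
  have htr := trace_evenPart_add_skewPart (γ := γ) (o := o) (μ := μ) (ω := ω) (Θ := Θ) hS
    (radius ω Θ)
  have hadj : ∀ x y, B (γ (cplx (quant V (evenPart o μ (radius ω Θ) Θ))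
      (quant V (skewPart o μ ω))) x) y = B x (γ (cplx (quant V (evenPart o μ (radius ω Θ) Θ))
      (quant V (skewPart o μ ω))) y) := fun x y => by
    rw [hB.adjoint, conjReverse_cplx, reverse_quant_evenPart, reverse_quant_skewPart, neg_neg]
  have hvol : rep γ (vol o) * γ (cplx (quant V (evenPart o μ (radius ω Θ) Θ))
      (quant V (skewPart o μ ω))) = (μ : ℂ) • γ (cplx (quant V (evenPart o μ (radius ω Θ) Θ))
      (quant V (skewPart o μ ω))) := by
    rw [apply_cplx, mul_add, mul_smul_comm, ← rep_mul, ← rep_mul,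
      vol_mul_quant_evenPart hμ h.selfDual, vol_mul_quant_skewPart hμ, rep_smul, rep_smul]
    module
  rw [← apply_cplx] at hsq htr
  obtain ⟨η, h1, h2, h3⟩ := hB.exists_eq_smulRight _ hadj (c := 16 * radius ω Θ)
    (mul_nonneg (by norm_num) (radius_nonneg ω Θ)) hsq (by rw [htr]; push_cast; rfl)
  refine ⟨η, ?_, ?_, h2⟩
  · rw [isChiral_iff]
    by_cases hη : η = 0
    · simp [hη]
    · have hc : ((16 * radius ω Θ : ℝ) : ℂ) ≠ 0 := by
        rw [← h2]
        intro h0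
        have := hB.pos_def η hη
        simp [h0] at this
      -- As `cη = Eη` with `c ≠ 0`, the spinor lies in the image of `E` and inherits its chirality.
      have h4 := LinearMap.congr_fun hvol η
      rw [Module.End.mul_apply, LinearMap.smul_apply, ← h3, map_smul, smul_comm] at h4
      exact smul_right_injective _ hc h4
  · rw [IsHermitianSquare, h.squareForm_eq hμ, quantize_cplx, ← apply_cplx, h1]

end HermitianSquare

end SpinorSquare

end

/-! ### The equivalence, for nonzero and for arbitrary spinors. -/

theorem mainTheorem7 {V : Type*} [NormedAddCommGroup V] [InnerProductSpace ℝ V]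
    [FiniteDimensional ℝ V] [Fact (Module.finrank ℝ V = 8)] (o : Orientation ℝ V (Fin 8))
    {S : Type*} [AddCommGroup S] [Module ℂ S]
    (γ : SpinorSquare.ComplexClifford V →ₐ[ℂ] Module.End ℂ S)
    (hγ : SpinorSquare.IsIrreducibleModule γ)
    (B : S →ₗ[ℂ] S →ₗ⋆[ℂ] ℂ) (hB : SpinorSquare.IsAdmissibleInner γ B)
    (μ : ℝ) (hμ : μ = 1 ∨ μ = -1) (α : SpinorSquare.ComplexForms V) :
    ((∃ η : S, η ≠ 0 ∧ SpinorSquare.IsChiral o γ μ η ∧ SpinorSquare.IsHermitianSquare γ B η α) ↔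
      ∃ (ω : ⋀[ℝ]^2 (Module.Dual ℝ V)) (Θ : ⋀[ℝ]^4 (Module.Dual ℝ V)), Θ ≠ 0 ∧
        SpinorSquare.SolvesSystem o μ ω Θ ∧ α = SpinorSquare.squareForm o μ ω Θ) ∧
    ((∃ η : S, SpinorSquare.IsChiral o γ μ η ∧ SpinorSquare.IsHermitianSquare γ B η α) ↔
      ∃ (ω : ⋀[ℝ]^2 (Module.Dual ℝ V)) (Θ : ⋀[ℝ]^4 (Module.Dual ℝ V)),
        SpinorSquare.SolvesSystem o μ ω Θ ∧ α = SpinorSquare.squareForm o μ ω Θ) := by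
  refine ⟨⟨?_, ?_⟩, ⟨?_, ?_⟩⟩
  · rintro ⟨η, hη, hchi, hsq⟩
    obtain ⟨ω, Θ, h1, h2, h3⟩ :=
      SpinorSquare.exists_solution_of_isHermitianSquare hγ hB hμ hchi hsq
    refine ⟨ω, Θ, fun hΘ => ?_, h1, h2⟩
    have hpos := hB.pos_def η hη
    rw [h3, h1.radius_eq_zero hμ hΘ] at hpos
    simp at hpos
  · rintro ⟨ω, Θ, hΘ, h1, rfl⟩
    obtain ⟨η, h2, h3, h4⟩ := SpinorSquare.exists_spinor_of_solvesSystem hγ hB hμ h1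
    refine ⟨η, fun hη => ?_, h2, h3⟩
    have hpos := SpinorSquare.radius_pos (ω := ω) hΘ
    rw [hη, map_zero] at h4
    have h5 : (16 * SpinorSquare.radius ω Θ : ℝ) = 0 := by exact_mod_cast h4.symm
    linarith
  · rintro ⟨η, hchi, hsq⟩
    obtain ⟨ω, Θ, h1, h2, _⟩ :=
      SpinorSquare.exists_solution_of_isHermitianSquare hγ hB hμ hchi hsq
    exact ⟨ω, Θ, h1, h2⟩
  · rintro ⟨ω, Θ, h1, rfl⟩
    obtain ⟨η, h2, h3, _⟩ := SpinorSquare.exists_spinor_of_solvesSystem hγ hB hμ h1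
    exact ⟨η, h2, h3⟩
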